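/- Let $B_0,B_1,B_2\subset\mathbb{N}$ be finite nonempty sets (the supports of $P_0,P_1,Q$ in a parameterization $x=P_0(t)/Q(t)$, $y=P_1(t)/Q(t)$), let $A_i=\{(0,1)\}\cup\{(b,0): b\in B_i\}\subset\mathbb{R}^2$ (the supports of $f_0=xr-P_0(t)$, $f_1=yr-P_1(t)$, $f_2=r-Q(t)$), and let $C_i=\mathrm{CH}(A_i)$ and $C=C_0+C_1+C_2$. A Minkowski cell is a 2-dimensional sum $R=R_0+R_1+R_2$ of convex polytopes $R_i$ with vertices in $A_i$. A mixed subdivision of $C$ is a finite family $S$ of Minkowski cells that cover $C$ and intersect properly: for any two cells $R,R'$ the set $R_i\cap R'_i$ is a (possibly empty) common face of $R_i$ and $R'_i$ for each $i$, and if $R\cap R'\neq\emptyset$, then it is a face of both with the same Minkowski description in both. $S$ is tight if $\sum_i\dim R_i=2$ for each of its cells. It is regular if, for some lifting functions $\omega_i:A_i\to\mathbb{R}$, its cells, with their Minkowski descriptions, are the projections of the 2-dimensional faces of the lower hull of the sum of the lifted polytopes $\mathrm{CH}\{(a,\omega_i(a)):a\in A_i\}$; it is induced by a linear lifting if each $\omega_i$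 can be chosen to be the restriction of a linear function on $\mathbb{R}^2$. For a tight mixed subdivision $S$ and $i\in\{0,1,2\}$ let $e_i(S)$ be the total area of the cells $R\in S$ with $R_i=\{(0,1)\}$ and the other two summands 1-dimensional. The point obtained by $S$ is $e(S)=(e_0(S),e_1(S))$, the exponent vector in $x,y$ of the monomial of the resultant of $f_0,f_1,f_2$ that corresponds to $S$. The implicit polygon $N(\phi)$ predicted by the supports is the convex hull of the points $e(S)$ over the regular tight mixed subdivisions $S$ of $C$. Say that $b\in B_j$ is used by $S$ if $(b,0)$ is a vertex of the summand $R_j$ of some $R\in S$. (1) Let $S$ be a tight mixed subdivision of $C$ and let $b_i\in B_i$, $\min B_i<b_i<\max B_i$, be such that $(b_i,2)=(b_i,0)+(0,1)+(0,1)$, with $(b_i,0)$ from the $i$-th summand, is a 0-dimensional face of $S$. Then $e(S)$ is a convex combination of points $e(S')$ obtained by tight mixed subdivisions $S'\ne S$ such that every $b\in B_j$ ($j\in\{0,1,2\}$) used by $S'$ is either an endpoint ($\min B_j$ or $\max B_j$) or is used by $S$ and is not the point $b_i$ of $B_i$. In particular $S$ is not needed for the vertices of $N(\phi)$: if $e(S)$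 is a vertex of $N(\phi)$, then $e(S)=e(S')$ for such an $S'$. (2) Only subdivisions induced by linear liftings matter: every tight mixed subdivision $S$ of $C$, regular or not, has $e(S)\in N(\phi)$, and $N(\phi)$ is the convex hull of the points $e(S)$ over the tight mixed subdivisions $S$ of $C$ that are induced by linear liftings. -/

import Mathlib

open scoped Pointwise

/-- Affine dimension of a nonempty subset of the plane. -/
noncomputable def affDim (X : Set (ℝ × ℝ)) : ℕ :=
  Module.finrank ℝ (vectorSpan ℝ X)

/-- A triple of subsets of the plane, read as the description `R 0 + R 1 + R 2` of a Minkowski sum.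
Cells and faces of mixed subdivisions are such labelled sums. -/
abbrev MinkowskiTriple := Fin 3 → Set (ℝ × ℝ)

/-- The Minkowski sum itself. -/
def MinkowskiTriple.total (R : MinkowskiTriple) : Set (ℝ × ℝ) :=
  R 0 + R 1 + R 2

/-- `F` is a face of the Minkowski sum `R`, with its Minkowski description: every summand of `F` is
the face of the corresponding summand of `R` on which one and the same linear functional is
maximal. -/
def MinkowskiTriple.IsFace (F R : MinkowskiTriple) : Prop :=
  ∃ l : (ℝ × ℝ) →L[ℝ] ℝ, ∀ i, F i = l.toExposed (R i)

/-- A Minkowski cell for the supports `A`: a full-dimensional sum of convex polytopes, the `i`-th of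
them with vertices in `A i`. -/
def IsMinkowskiCell (A R : MinkowskiTriple) : Prop :=
  (∀ i, ∃ V : Set (ℝ × ℝ), V ⊆ A i ∧ V.Nonempty ∧ R i = convexHull ℝ V) ∧ affDim R.total = 2

/-- Two Minkowski cells intersect properly: corresponding summands intersect in a (possibly empty)
common face, and if the two cells meet, they meet in a common face which has the same Minkowski
description in both. -/
def IntersectProperly (R R' : MinkowskiTriple) : Prop :=
  (∀ i, IsExposed ℝ (R i) (R i ∩ R' i) ∧ IsExposed ℝ (R' i) (R i ∩ R' i)) ∧
  ((R.total ∩ R'.total).Nonempty →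
    ∃ F : MinkowskiTriple, F.IsFace R ∧ F.IsFace R' ∧ R.total ∩ R'.total = F.total)

/-- A mixed subdivision of `CH(A 0) + CH(A 1) + CH(A 2)`: a finite family of Minkowski cells which
cover this polygon and pairwise intersect properly (so distinct cells have disjoint interiors). -/
def IsMixedSubdivision (A : MinkowskiTriple) (S : Finset MinkowskiTriple) : Prop :=
  (∀ R ∈ S, IsMinkowskiCell A R) ∧
  (⋃ R ∈ S, R.total) = MinkowskiTriple.total (fun i => convexHull ℝ (A i)) ∧
  (∀ R ∈ S, ∀ R' ∈ S, IntersectProperly R R')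

/-- A tight mixed subdivision: in every cell the dimensions of the summands add up to the dimension
of the cell, which is `2`. -/
def IsTightMixedSubdivision (A : MinkowskiTriple) (S : Finset MinkowskiTriple) : Prop :=
  IsMixedSubdivision A S ∧ ∀ R ∈ S, ∑ i, affDim (R i) = 2

/-- The face of the lower hull of the lifted Minkowski sum, with summands
`CH {(a, ω i a) | a ∈ A i}`, on which the functional `(p, h) ↦ l p + h` is minimal, projected to the
plane and with its Minkowski description. -/
def lowerFace (A : MinkowskiTriple) (ω : Fin 3 → ℝ × ℝ → ℝ) (l : (ℝ × ℝ) →L[ℝ] ℝ) :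
    MinkowskiTriple :=
  fun i => convexHull ℝ {a ∈ A i | ∀ a' ∈ A i, l a + ω i a ≤ l a' + ω i a'}

/-- `S` is induced by the lifting `ω`: its cells are the projections of the full-dimensional faces
of the lower hull of the lifted Minkowski sum. -/
def IsInducedBy (A : MinkowskiTriple) (ω : Fin 3 → ℝ × ℝ → ℝ) (S : Finset MinkowskiTriple) : Prop :=
  ∀ R : MinkowskiTriple, R ∈ S ↔ ∃ l, R = lowerFace A ω l ∧ affDim R.total = 2

/-- `S` is regular: it is induced by some lifting. -/
def IsRegularSubdivision (A : MinkowskiTriple) (S : Finset MinkowskiTriple) : Prop :=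
  ∃ ω : Fin 3 → ℝ × ℝ → ℝ, IsInducedBy A ω S

/-- `S` is induced by a linear lifting: the lifting is a linear function on each support. -/
def IsLinearlyInduced (A : MinkowskiTriple) (S : Finset MinkowskiTriple) : Prop :=
  ∃ ω : Fin 3 → ((ℝ × ℝ) →ₗ[ℝ] ℝ), IsInducedBy A (fun i => ω i) S

/-- The supports in the variables `(t, r)` of `f₀ = x r - P₀(t)`, `f₁ = y r - P₁(t)`,
`f₂ = r - Q(t)`, where `B 0`, `B 1`, `B 2` are the supports of `P₀`, `P₁`, `Q`:
`A i = {(0, 1)} ∪ {(b, 0) | b ∈ B i}`. -/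
def curveSupports (B : Fin 3 → Finset ℕ) : MinkowskiTriple :=
  fun i => insert ((0 : ℝ), (1 : ℝ)) {p | ∃ b ∈ B i, p = ((b : ℝ), (0 : ℝ))}

/-- `R` is an `i`-mixed cell whose vertex summand is `(0, 1)`, the exponent of the monomial of `fᵢ`
that depends on `r`; the other two summands are segments. -/
def IsApexMixed (i : Fin 3) (R : MinkowskiTriple) : Prop :=
  R i = {((0 : ℝ), (1 : ℝ))} ∧ ∀ j, j ≠ i → affDim (R j) = 1

open Classical in
/-- `eᵢ`: the total area of the `i`-mixed cells of `S` with vertex summand `(0, 1)`. -/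
noncomputable def mixedExponent (S : Finset MinkowskiTriple) (i : Fin 3) : ℝ :=
  ∑ R ∈ S with IsApexMixed i R, MeasureTheory.volume.real R.total

/-- The point `(e₀, e₁)` obtained by `S`: the exponents of `x` and `y` in the monomial of the
resultant of `f₀, f₁, f₂` that corresponds to `S`. -/
noncomputable def obtainedPoint (S : Finset MinkowskiTriple) : ℝ × ℝ :=
  (mixedExponent S 0, mixedExponent S 1)

/-- The implicit polygon for the supports `B`: the convex hull of the exponents `(e₀, e₁)` of `x, y`
in the extreme monomials of the resultant, which are those that correspond to the regular tight
mixed subdivisions. -/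
def implicitPolygon (B : Fin 3 → Finset ℕ) : Set (ℝ × ℝ) :=
  convexHull ℝ {q | ∃ S, IsTightMixedSubdivision (curveSupports B) S ∧
    IsRegularSubdivision (curveSupports B) S ∧ q = obtainedPoint S}

/-- The point `(b, 2) = (b, 0) + (0, 1) + (0, 1)`, with `(b, 0)` taken from the `i`-th summand, is a
0-dimensional face of `S`. -/
def IsZeroFaceOnL (S : Finset MinkowskiTriple) (i : Fin 3) (b : ℕ) : Prop :=
  ∃ R ∈ S, MinkowskiTriple.IsFace
    (fun j => if j = i then {((b : ℝ), (0 : ℝ))} else {((0 : ℝ), (1 : ℝ))}) R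

/-- The exponent `b` of the `j`-th support is used in defining `S`: `(b, 0)` is a vertex of the
`j`-th summand of some cell. -/
def IsUsed (S : Finset MinkowskiTriple) (j : Fin 3) (b : ℕ) : Prop :=
  ∃ R ∈ S, ((b : ℝ), (0 : ℝ)) ∈ (R j).extremePoints ℝ

/-- `b` is an endpoint of the Newton segment of `B j`. -/
def IsEndpoint (B : Fin 3 → Finset ℕ) (j : Fin 3) (b : ℕ) : Prop :=
  b ∈ B j ∧ ((∀ c ∈ B j, b ≤ c) ∨ ∀ c ∈ B j, c ≤ b)

/-- `S'` is a tight mixed subdivision defined by exponents each of which is an endpoint of its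
Newton segment, or is used in defining `S` and is not the exponent `b` of the `i`-th support. -/
def IsReplacement (B : Fin 3 → Finset ℕ) (S : Finset MinkowskiTriple) (i : Fin 3) (b : ℕ)
    (S' : Finset MinkowskiTriple) : Prop :=
  IsTightMixedSubdivision (curveSupports B) S' ∧
  ∀ j c, IsUsed S' j c → IsEndpoint B j c ∨ (IsUsed S j c ∧ ¬(j = i ∧ c = b))

/-!
A horizontal line at height `3 / 2` meets the cells of a tight mixed subdivision in segments. On the
boundary between two consecutive cells one summand lies on the first coordinate axis, one is halfway
to the apex and one is at the apex, so reading the subdivision from left to right gives a path of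
such states, and only cells with the apex as a summand move the state along the axis. Hence the
exponents are determined by the path: they sum to the length of the Newton segment, and for a
weight `w` with maximum `w p` the two ends of the path force `∑ i, (w p - w i) * e i` to be at least
the sum of two end costs, which depend only on the minima and the maxima of the supports.

The lower faces for a linear lifting are described by three concave piecewise linear functions with
two pieces each, one for every support. When they take the values `w` near a common kink, the
apex cells sit exactly where the end costs are incurred, so equality holds for generic `w`.
Separating a point from a convex hull by a generic functional, the points obtained by linear
liftings therefore have all others in their convex hull. A linear lifting never breaks a Newton
segment at an interior point, so the subdivisions it induces use endpoints only.
-/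

open MeasureTheory Filter Topology

/-- The three elements of `Fin 3`, listed in some order. -/
structure IsLabelling (i j k : Fin 3) : Prop where
  ne₁₂ : i ≠ j
  ne₁₃ : i ≠ k
  ne₂₃ : j ≠ k

namespace IsLabelling

variable {i j k : Fin 3}

theorem swap₁₂ (h : IsLabelling i j k) : IsLabelling j i k := ⟨h.ne₁₂.symm, h.ne₂₃, h.ne₁₃⟩

theorem swap₂₃ (h : IsLabelling i j k) : IsLabelling i k j := ⟨h.ne₁₃, h.ne₁₂, h.ne₂₃.symm⟩

theorem eq_or (h : IsLabelling i j k) (l : Fin 3) : l = i ∨ l = j ∨ l = k := by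
  obtain ⟨h₁, h₂, h₃⟩ := h
  omega

theorem forall_iff (h : IsLabelling i j k) {p : Fin 3 → Prop} : (∀ l, p l) ↔ p i ∧ p j ∧ p k := by
  refine ⟨fun hp => ⟨hp i, hp j, hp k⟩, fun ⟨hi, hj, hk⟩ l => ?_⟩
  rcases h.eq_or l with rfl | rfl | rfl <;> assumption

theorem sum_eq {A : Type*} [AddCommMonoid A] (h : IsLabelling i j k) (f : Fin 3 → A) :
    ∑ l, f l = f i + f j + f k := by
  have huniv : (Finset.univ : Finset (Fin 3)) = {i, j, k} := by
    ext l
    simpa using h.eq_or l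
  rw [huniv, Finset.sum_insert (by simp [h.ne₁₂, h.ne₁₃]), Finset.sum_pair h.ne₂₃, add_assoc]

end IsLabelling

/-! ### Paths of states of a horizontal section -/

/-- The position on the boundary of a cell of the horizontal section at height `3 / 2` of a mixed
subdivision: the `a`-th summand is at `(x, 0)`, the `b`-th is halfway between `(y, 0)` and the apex
`(0, 1)`, and the `c`-th is at the apex. -/
@[ext] structure SliceState where
  a : Fin 3
  b : Fin 3
  c : Fin 3
  x : ℝ
  y : ℝ

namespace SliceState

/-- The labels are distinct, and the coordinates lie in the Newton segments `[m i, M i]`. -/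
structure Valid (m M : Fin 3 → ℝ) (s : SliceState) : Prop where
  isLabelling : IsLabelling s.a s.b s.c
  mem_a : s.x ∈ Set.Icc (m s.a) (M s.a)
  mem_b : s.y ∈ Set.Icc (m s.b) (M s.b)

/-- The state of the mirror image of the section. -/
def reflect (s : SliceState) : SliceState := ⟨s.a, s.b, s.c, -s.x, -s.y⟩

/-- Crossing a cell of a tight mixed subdivision from left to right, together with the area by which
the cell contributes to the three exponents. The summands of the cell are a triangle, a point of the
base and the apex in `moveMid`; an edge on the base, a slanted edge and the apex in `moveLow`; two
slanted edges and the apex in `swapLow`; two slanted edges and a point of the base in `swapTop`. -/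
inductive Step : SliceState → SliceState → (Fin 3 → ℝ) → Prop
  | moveMid {a b c : Fin 3} {x y y' : ℝ} : y ≤ y' → Step ⟨a, b, c, x, y⟩ ⟨a, b, c, x, y'⟩ 0
  | moveLow {a b c : Fin 3} {x x' y : ℝ} : x ≤ x' →
      Step ⟨a, b, c, x, y⟩ ⟨a, b, c, x', y⟩ (Pi.single c (x' - x))
  | swapLow {a b c : Fin 3} {x y : ℝ} : x ≤ y →
      Step ⟨a, b, c, x, y⟩ ⟨b, a, c, y, x⟩ (Pi.single c (y - x))
  | swapTop {a b c : Fin 3} {x y z : ℝ} : y ≤ z → Step ⟨a, b, c, x, y⟩ ⟨a, c, b, x, z⟩ 0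

/-- A sequence of steps through valid states, with the total contribution to the exponents. -/
inductive Path (m M : Fin 3 → ℝ) (s : SliceState) : SliceState → (Fin 3 → ℝ) → Prop
  | refl : s.Valid m M → Path m M s s 0
  | snoc {t r : SliceState} {e w : Fin 3 → ℝ} :
      Path m M s t e → Step t r w → r.Valid m M → Path m M s r (e + w)

variable {m M : Fin 3 → ℝ} {s t r : SliceState} {e e' w : Fin 3 → ℝ}

theorem Path.valid_right (h : Path m M s t e) : t.Valid m M := by
  cases h <;> assumption

theorem Path.valid_left (h : Path m M s t e) : s.Valid m M := by
  induction h <;> assumption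

theorem Step.nonneg (h : Step s t w) : 0 ≤ w := by
  cases h with
  | moveMid | swapTop => exact le_rfl
  | moveLow h | swapLow h => exact Pi.single_nonneg.2 (sub_nonneg.2 h)

theorem Path.nonneg (h : Path m M s t e) : 0 ≤ e := by
  induction h with
  | refl => exact le_rfl
  | snoc _ hw _ ih => exact add_nonneg ih hw.nonneg

theorem Step.sum_eq (h : Step s t w) : ∑ i, w i = t.x - s.x := by
  cases h <;> simp

theorem Path.sum_eq (h : Path m M s t e) : ∑ i, e i = t.x - s.x := by
  induction h with
  | refl => simp
  | snoc _ hw _ ih =>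
    simp only [Pi.add_apply, Finset.sum_add_distrib, ih, hw.sum_eq]
    ring

theorem Path.trans (h : Path m M s t e) (h' : Path m M t r e') : Path m M s r (e + e') := by
  induction h' with
  | refl => simpa using h
  | snoc _ hw hr ih => exact add_assoc e _ _ ▸ ih.snoc hw hr

theorem Valid.reflect (h : s.Valid m M) : s.reflect.Valid (-M) (-m) :=
  ⟨h.isLabelling, ⟨neg_le_neg h.mem_a.2, neg_le_neg h.mem_a.1⟩,
    ⟨neg_le_neg h.mem_b.2, neg_le_neg h.mem_b.1⟩⟩

theorem Step.reflect (h : Step s t w) : Step t.reflect s.reflect w := by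
  cases h with
  | moveMid h => exact .moveMid (neg_le_neg h)
  | @moveLow a b c x x' y h => exact neg_sub_neg x x' ▸ .moveLow (neg_le_neg h)
  | @swapLow a b c x y h => exact neg_sub_neg x y ▸ .swapLow (neg_le_neg h)
  | swapTop h => exact .swapTop (neg_le_neg h)

theorem Path.reflect (h : Path m M s t e) : Path (-M) (-m) t.reflect s.reflect e := by
  induction h with
  | refl h => exact .refl h.reflect
  | @snoc t r e w h hw hr ih =>
    have hrt := (Path.refl hr.reflect).snoc hw.reflect h.valid_right.reflect
    rw [zero_add] at hrt
    exact add_comm w e ▸ hrt.trans ih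

/-- The `α`-th summand has not been at the apex so far (first two fields). A summand that has been
there came down from it above the left ends of the summands other than the `α`-th, as the summand
that replaced it was to its left (last two fields). -/
structure BeforeApex (m : Fin 3 → ℝ) (α : Fin 3) (t : SliceState) (e : Fin 3 → ℝ) : Prop where
  c_ne : t.c ≠ α
  exponent_eq_zero : e α = 0
  le_x : e t.a ≠ 0 → ∀ j ≠ α, m j ≤ t.x
  le_y : e t.b ≠ 0 → ∀ j ≠ α, m j ≤ t.y

theorem BeforeApex.step {α : Fin 3} (h : BeforeApex m α t e) (ht : t.Valid m M) (hw : Step t r w)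
    (hr : r.Valid m M) (hrα : r.c ≠ α) : BeforeApex m α r (e + w) := by
  obtain ⟨hc, he, hx, hy⟩ := h
  have hl := ht.isLabelling
  cases hw with
  | moveMid hle =>
    simp only [add_zero]
    exact ⟨hc, he, hx, fun h j hj => (hy h j hj).trans hle⟩
  | moveLow hle =>
    exact ⟨hc, by simp [he, hc.symm],
      fun h j hj => (hx (by simpa [hl.ne₁₃] using h) j hj).trans hle,
      fun h => hy (by simpa [hl.ne₂₃] using h)⟩
  | swapLow hle =>
    exact ⟨hc, by simp [he, hc.symm], fun h => hy (by simpa [hl.ne₂₃] using h),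
      fun h => hx (by simpa [hl.ne₁₃] using h)⟩
  | @swapTop a b c x y z hle =>
    simp only [add_zero]
    refine ⟨hrα, he, hx, fun _ j hj => ?_⟩
    obtain rfl : α = a := by rcases hl.eq_or α with h | h | h <;> simp_all
    rcases hl.eq_or j with rfl | rfl | rfl
    · exact absurd rfl hj
    · exact ht.mem_b.1.trans hle
    · exact hr.mem_b.1

/-- A lower bound, caused by one end of the section, for the exponents weighted by `W`: if the
section starts with the `α`-th summand at its left end `m α`, then this summand has to be lifted to
the apex, on its own or after another summand has come down from it. -/
def endCost (m W : Fin 3 → ℝ) (α β γ : Fin 3) : ℝ :=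
  min (W β * max (m γ - m α) 0) (W γ * max (m β - m α) 0)

variable {W : Fin 3 → ℝ} {α β γ : Fin 3}

theorem endCost_comm (m W : Fin 3 → ℝ) (α β γ : Fin 3) : endCost m W α β γ = endCost m W α γ β :=
  min_comm _ _

theorem endCost_eq_zero (hW : 0 ≤ W) (h : m β ≤ m α) : endCost m W α β γ = 0 := by
  have := mul_nonneg (hW β) (le_max_right (m γ - m α) 0)
  simpa [endCost, max_eq_right (sub_nonpos.2 h)] using this

theorem min_mul_add_le {u v x y : ℝ} (hx : 0 ≤ x) (hy : 0 ≤ y) :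
    min u v * (x + y) ≤ u * x + v * y := by
  rw [mul_add]
  gcongr
  exacts [min_le_left u v, min_le_right u v]

theorem endCost_le_min_mul (hW : 0 ≤ W) {d : ℝ} (hβ : max (m β - m α) 0 ≤ d)
    (hγ : max (m γ - m α) 0 ≤ d) : endCost m W α β γ ≤ min (W β) (W γ) * d := by
  rw [min_mul_of_nonneg _ _ ((le_max_right _ _).trans hβ)]
  exact min_le_min (mul_le_mul_of_nonneg_left hγ (hW β)) (mul_le_mul_of_nonneg_left hβ (hW γ))

theorem BeforeApex.endCost_le (h : BeforeApex m t.b t e) (ht : t.Valid m M) (hW : 0 ≤ W)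
    (he : 0 ≤ e) (hsum : t.x - m t.b ≤ ∑ i, e i) :
    endCost m W t.b t.a t.c ≤ ∑ i, W i * e i := by
  have hl := ht.isLabelling
  have ha : 0 ≤ e t.a := he t.a
  have hc : 0 ≤ e t.c := he t.c
  have hx := ht.mem_a.1
  rw [hl.sum_eq, h.exponent_eq_zero, add_zero] at hsum
  rw [hl.sum_eq, h.exponent_eq_zero, mul_zero, add_zero]
  by_cases h0 : e t.a = 0
  · rw [h0, zero_add] at hsum
    rw [h0, mul_zero, zero_add]
    exact (min_le_right _ _).trans
      (mul_le_mul_of_nonneg_left (max_le (by linarith) hc) (hW t.c))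
  · have hcx := h.le_x h0 t.c hl.ne₂₃.symm
    exact (endCost_le_min_mul hW (max_le (by linarith) (by linarith))
      (max_le (by linarith) (by linarith))).trans (min_mul_add_le ha hc)

theorem endCost_congr (h : IsLabelling α β γ) {i k : Fin 3} (h' : IsLabelling α i k) :
    endCost m W α i k = endCost m W α β γ := by
  rcases h.eq_or i with rfl | rfl | rfl
  · exact absurd rfl h'.ne₁₂
  · rcases h.eq_or k with rfl | rfl | rfl
    exacts [absurd rfl h'.ne₁₃, absurd rfl h'.ne₂₃, rfl]
  · rcases h.eq_or k with rfl | rfl | rfl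
    exacts [absurd rfl h'.ne₁₃, endCost_comm .., absurd rfl h'.ne₂₃]

theorem Step.b_eq_of_c_ne (h : Step t r w) (hc : t.c ≠ r.c) : w = 0 ∧ r.c = t.b := by
  cases h <;> simp_all

theorem Path.beforeApex_or_exists (h : Path m M s t e) (hl : IsLabelling α β γ) (hW : 0 ≤ W)
    (hs : s.x ≤ m α) :
    BeforeApex m α t e ∨ ∃ r e₁ e₂, Path m M s r e₁ ∧ Path m M r t e₂ ∧ r.c = α ∧ e = e₁ + e₂ ∧
      endCost m W α β γ ≤ ∑ i, W i * e₁ i := by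
  induction h with
  | refl hv =>
    by_cases hc : s.c = α
    · refine .inr ⟨s, 0, 0, .refl hv, .refl hv, hc, (add_zero 0).symm, ?_⟩
      have hα := hv.isLabelling.swap₂₃.swap₁₂
      rw [hc] at hα
      rw [← endCost_congr hl hα, endCost_eq_zero hW (hv.mem_a.1.trans hs)]
      simp
    · exact .inl ⟨hc, rfl, by simp, by simp⟩
  | @snoc t r e w h hw hr ih =>
    rcases ih with hbefore | ⟨q, e₁, e₂, h₁, h₂, hq, rfl, hcost⟩
    · by_cases hc : r.c = α
      · obtain ⟨rfl, hb⟩ := hw.b_eq_of_c_ne (hc ▸ hbefore.c_ne)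
        refine .inr ⟨r, e + 0, 0, h.snoc hw hr, .refl hr, hc, (add_zero _).symm, ?_⟩
        obtain rfl : t.b = α := hb.symm.trans hc
        rw [← endCost_congr hl h.valid_right.isLabelling.swap₁₂, add_zero]
        exact hbefore.endCost_le h.valid_right hW h.nonneg (by linarith [h.sum_eq])
      · exact .inl (hbefore.step h.valid_right hw hr hc)
    · exact .inr ⟨q, e₁, e₂ + w, h₁, h₂.snoc hw hr, hq, add_assoc .., hcost⟩

theorem Path.endCost_add_endCost_le (h : Path m M s t e) (hl : IsLabelling α β γ) (hW : 0 ≤ W)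
    (hs : ∀ i, s.x ≤ m i) (ht : ∀ i, M i ≤ t.x) (hmM : m ≤ M) :
    endCost m W α β γ + endCost (-M) W α β γ ≤ ∑ i, W i * e i := by
  rcases h.beforeApex_or_exists hl hW (hs α) with hbefore | ⟨r, e₁, e₂, -, h₂, hr, rfl, h₁⟩
  · have hsum := h.sum_eq
    rw [hl.sum_eq, hbefore.exponent_eq_zero, zero_add] at hsum
    have hend (i) : max (m i - m α) 0 + max ((-M) i - (-M) α) 0 ≤ e β + e γ := by
      have := hmM α
      have := hmM i
      grind [Pi.neg_apply]
    have hcost {u : ℝ} (hu : 0 ≤ u) (i) :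
        u * max (m i - m α) 0 + u * max ((-M) i - (-M) α) 0 ≤ u * (e β + e γ) := by
      rw [← mul_add]
      exact mul_le_mul_of_nonneg_left (hend i) hu
    calc endCost m W α β γ + endCost (-M) W α β γ
      _ ≤ min (W β * (e β + e γ)) (W γ * (e β + e γ)) :=
        le_min ((add_le_add (min_le_left _ _) (min_le_left _ _)).trans (hcost (hW β) γ))
          ((add_le_add (min_le_right _ _) (min_le_right _ _)).trans (hcost (hW γ) β))
      _ = min (W β) (W γ) * (e β + e γ) :=
        (min_mul_of_nonneg _ _ (add_nonneg (h.nonneg β) (h.nonneg γ))).symm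
      _ ≤ W β * e β + W γ * e γ := min_mul_add_le (h.nonneg β) (h.nonneg γ)
      _ = ∑ i, W i * e i := by rw [hl.sum_eq, hbefore.exponent_eq_zero, mul_zero, zero_add]
  · rcases h₂.reflect.beforeApex_or_exists hl hW (neg_le_neg (ht α)) with
      hbefore | ⟨r', e₃, e₄, -, h₄, -, rfl, h₃⟩
    · exact absurd hr hbefore.c_ne
    · have h₄ : 0 ≤ ∑ i, W i * e₄ i := Finset.sum_nonneg fun i _ => mul_nonneg (hW i) (h₄.nonneg i)
      simp only [Pi.add_apply, mul_add, Finset.sum_add_distrib]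
      linarith

end SliceState

/-! ### Minkowski sums in the plane -/

theorem sum_injOn_of_sum_finrank_vectorSpan_le {ι 𝕜 E : Type*} [Fintype ι] [DivisionRing 𝕜]
    [AddCommGroup E] [Module 𝕜 E] [FiniteDimensional 𝕜 E] {R : ι → Set E}
    (h : ∑ i, Module.finrank 𝕜 (vectorSpan 𝕜 (R i)) ≤
      Module.finrank 𝕜 (vectorSpan 𝕜 (∑ i, R i))) :
    Set.InjOn (fun q : ι → E => ∑ i, q i) {q | ∀ i, q i ∈ R i} := by
  let sumMap : (∀ i, vectorSpan 𝕜 (R i)) →ₗ[𝕜] E :=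
    ∑ i, (vectorSpan 𝕜 (R i)).subtype ∘ₗ LinearMap.proj i
  have apply_sub {q q' : ι → E} (hq : ∀ i, q i ∈ R i) (hq' : ∀ i, q' i ∈ R i) :
      sumMap (fun i => ⟨q i - q' i, vsub_mem_vectorSpan 𝕜 (hq i) (hq' i)⟩) =
        ∑ i, q i - ∑ i, q' i := by
    simp [sumMap]
  have hrange : vectorSpan 𝕜 (∑ i, R i) ≤ LinearMap.range sumMap := by
    rw [vectorSpan_def, Submodule.span_le]
    rintro _ ⟨p, hp, p', hp', rfl⟩
    obtain ⟨q, hq, rfl⟩ := Set.mem_fintype_sum _ _ |>.1 hp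
    obtain ⟨q', hq', rfl⟩ := Set.mem_fintype_sum _ _ |>.1 hp'
    exact ⟨_, apply_sub @hq @hq'⟩
  have hker : LinearMap.ker sumMap = ⊥ := by
    rw [← Submodule.finrank_eq_zero (R := 𝕜)]
    have hdim := LinearMap.finrank_range_add_finrank_ker sumMap
    rw [Module.finrank_pi_fintype] at hdim
    have := Submodule.finrank_mono hrange
    omega
  intro q hq q' hq' hsum
  have hzero := LinearMap.ker_eq_bot'.1 hker _ ((apply_sub hq hq').trans (sub_eq_zero.2 hsum))
  funext i
  exact sub_eq_zero.1 (congrArg Subtype.val (congrFun hzero i))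

theorem linear_apply_prod {F R : Type*} [CommSemiring R] [FunLike F (R × R) R]
    [LinearMapClass F R (R × R) R] (l : F) (p : R × R) :
    l p = l (1, 0) * p.1 + l (0, 1) * p.2 := by
  have hp : p = p.1 • ((1, 0) : R × R) + p.2 • ((0, 1) : R × R) := by ext <;> simp
  conv_lhs => rw [hp, map_add, map_smul, map_smul, smul_eq_mul, smul_eq_mul]
  ring

theorem affDim_eq_two_iff_vectorSpan_eq_top {X : Set (ℝ × ℝ)} :
    affDim X = 2 ↔ vectorSpan ℝ X = ⊤ := by
  rw [affDim, Submodule.eq_top_iff_finrank_eq, Module.finrank_prod, Module.finrank_self]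

theorem affDim_singleton (p : ℝ × ℝ) : affDim {p} = 0 := by
  simp [affDim]

theorem affDim_segment {p q : ℝ × ℝ} (h : p ≠ q) : affDim (segment ℝ p q) = 1 := by
  rw [affDim, vectorSpan_segment]
  exact finrank_span_singleton (by simpa [sub_eq_zero] using h.symm)

theorem volume_real_segment_add_segment (p p' q q' : ℝ × ℝ) :
    volume.real (segment ℝ p p' + segment ℝ q q') =
      |(p'.1 - p.1) * (q'.2 - q.2) - (p'.2 - p.2) * (q'.1 - q.1)| := by
  let f : ℝ × ℝ →ₗ[ℝ] ℝ × ℝ := Matrix.toLin (Module.Basis.finTwoProd ℝ) (Module.Basis.finTwoProd ℝ)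
    !![p'.1 - p.1, q'.1 - q.1; p'.2 - p.2, q'.2 - q.2]
  have hf (z : ℝ × ℝ) : f z = z.1 • (p' - p) + z.2 • (q' - q) := by
    rw [Matrix.toLin_finTwoProd_apply]
    ext <;> simp <;> ring
  have himage : segment ℝ p p' + segment ℝ q q' =
      (p + q) +ᵥ (f '' (Set.Icc (0 : ℝ) 1 ×ˢ Set.Icc (0 : ℝ) 1)) := by
    rw [segment_eq_image', segment_eq_image', ← Set.image_vadd, Set.image_image, ← Set.image2_add,
      Set.image2_image_left, Set.image2_image_right, ← Set.image_prod]
    refine Set.image_congr fun z _ => ?_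
    rw [hf, vadd_eq_add]
    abel
  rw [himage, Measure.real, measure_vadd, Measure.addHaar_image_linearMap, LinearMap.det_toLin,
    Measure.volume_eq_prod, Measure.prod_prod]
  simp only [Matrix.det_fin_two_of, Real.volume_Icc, sub_zero, ENNReal.ofReal_one, mul_one,
    ENNReal.toReal_ofReal (abs_nonneg _)]
  ring_nf

namespace MinkowskiTriple

variable {R : MinkowskiTriple} {i j k : Fin 3}

theorem total_eq_sum (R : MinkowskiTriple) : R.total = ∑ i, R i :=
  (Fin.sum_univ_three R).symm

theorem total_eq (R : MinkowskiTriple) (h : IsLabelling i j k) : R.total = R i + R j + R k := by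
  rw [total_eq_sum, h.sum_eq]

theorem mem_total {p : ℝ × ℝ} :
    p ∈ R.total ↔ ∃ q : Fin 3 → ℝ × ℝ, (∀ i, q i ∈ R i) ∧ ∑ i, q i = p := by
  simp [total_eq_sum, Set.mem_fintype_sum]

theorem sum_mem_total {q : Fin 3 → ℝ × ℝ} (hq : ∀ i, q i ∈ R i) : ∑ i, q i ∈ R.total :=
  mem_total.2 ⟨q, hq, rfl⟩

theorem sum_injOn (h : ∑ i, affDim (R i) ≤ affDim R.total) :
    Set.InjOn (fun q : Fin 3 → ℝ × ℝ => ∑ i, q i) {q | ∀ i, q i ∈ R i} :=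
  sum_injOn_of_sum_finrank_vectorSpan_le (𝕜 := ℝ) (R.total_eq_sum ▸ h)

theorem convex_total (h : ∀ i, Convex ℝ (R i)) : Convex ℝ R.total :=
  ((h 0).add (h 1)).add (h 2)

theorem total_mono {R' : MinkowskiTriple} (h : ∀ i, R i ⊆ R' i) : R.total ⊆ R'.total :=
  Set.add_subset_add (Set.add_subset_add (h 0) (h 1)) (h 2)

theorem eq_zero_of_affDim_total_eq_two (h : affDim R.total = 2) (f : ℝ × ℝ →ₗ[ℝ] ℝ)
    (hf : ∀ i, ∀ p ∈ R i, ∀ q ∈ R i, f p = f q) : f = 0 := by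
  rw [← LinearMap.ker_eq_top, ← top_le_iff, ← affDim_eq_two_iff_vectorSpan_eq_top.1 h,
    vectorSpan_def, Submodule.span_le]
  rintro _ ⟨_, hp, _, hq, rfl⟩
  obtain ⟨p, hpR, rfl⟩ := mem_total.1 hp
  obtain ⟨q, hqR, rfl⟩ := mem_total.1 hq
  simp [fun i => hf i _ (hpR i) _ (hqR i)]

theorem volume_real_total_eq (R : MinkowskiTriple) {i j k : Fin 3} {p : ℝ × ℝ}
    (hl : IsLabelling i j k) (hk : R k = {p}) :
    volume.real R.total = volume.real (R i + R j) := by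
  rw [R.total_eq hl, hk, Set.add_singleton]
  simp only [measureReal_def, add_comm _ p, Set.image_add_left, measure_preimage_add]

theorem IsFace.subset {F : MinkowskiTriple} (h : F.IsFace R) (i : Fin 3) : F i ⊆ R i := by
  obtain ⟨l, hl⟩ := h
  exact hl i ▸ fun x hx => hx.1

end MinkowskiTriple

open Classical in
/-- The summand of `mixedExponent` that belongs to the cell `R`. -/
noncomputable def contribution (R : MinkowskiTriple) (i : Fin 3) : ℝ :=
  if IsApexMixed i R then volume.real R.total else 0

theorem mixedExponent_eq_sum (S : Finset MinkowskiTriple) :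
    mixedExponent S = ∑ R ∈ S, contribution R := by
  funext i
  rw [mixedExponent, Finset.sum_filter, Finset.sum_apply]
  rfl

section Contribution

variable {R : MinkowskiTriple} {i j k : Fin 3}

theorem IsApexMixed.affDim_eq_zero (h : IsApexMixed i R) : affDim (R i) = 0 := by
  rw [h.1, affDim_singleton]

theorem contribution_eq_zero (h : ∀ i, ¬ IsApexMixed i R) : contribution R = 0 :=
  funext fun i => if_neg (h i)

theorem contribution_eq_single (hl : IsLabelling i j k) (hi : affDim (R i) = 1)
    (hj : affDim (R j) = 1) (hk : R k = {((0 : ℝ), (1 : ℝ))}) :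
    contribution R = Pi.single k (volume.real (R i + R j)) := by
  have hmixed : IsApexMixed k R := by
    refine ⟨hk, fun l hlk => ?_⟩
    rcases hl.eq_or l with rfl | rfl | rfl
    exacts [hi, hj, absurd rfl hlk]
  funext l
  by_cases h : l = k
  · rw [h, Pi.single_eq_same, ← R.volume_real_total_eq hl hk]
    exact if_pos hmixed
  · rw [Pi.single_eq_of_ne h]
    exact if_neg fun hl => by simpa [hmixed.2 l h] using hl.affDim_eq_zero

end Contribution

/-! ### Polytopes with vertices in one support -/

/-- A segment on the first coordinate axis. -/
def baseEdge (b c : ℝ) : Set (ℝ × ℝ) := {p | b ≤ p.1 ∧ p.1 ≤ c ∧ p.2 = 0}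

/-- The triangle with apex `(0, 1)` over the segment `[b, c]` of the first coordinate axis; it is a
slanted segment if `b = c`. -/
def apexCone (b c : ℝ) : Set (ℝ × ℝ) :=
  {p | 0 ≤ p.2 ∧ p.2 ≤ 1 ∧ b * (1 - p.2) ≤ p.1 ∧ p.1 ≤ c * (1 - p.2)}

/-- The support in the plane of a polynomial `r - P(t)`, where `T` is the support of `P`. -/
def apexSupport (T : Set ℝ) : Set (ℝ × ℝ) := insert (0, 1) ((fun b => (b, 0)) '' T)

section Polytopes

variable {b c : ℝ} {V : Set (ℝ × ℝ)}

theorem apex_mem_apexCone (b c : ℝ) : ((0 : ℝ), (1 : ℝ)) ∈ apexCone b c := by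
  simp [apexCone]

theorem base_mem_apexCone {x : ℝ} (hb : b ≤ x) (hc : x ≤ c) : (x, (0 : ℝ)) ∈ apexCone b c := by
  simp [apexCone, hb, hc]

theorem mem_apexCone_self_iff {p : ℝ × ℝ} :
    p ∈ apexCone b b ↔ 0 ≤ p.2 ∧ p.2 ≤ 1 ∧ p.1 = b * (1 - p.2) := by
  simp only [apexCone, Set.mem_ofPred_eq, ← le_antisymm_iff, eq_comm]

theorem convex_apexCone (b c : ℝ) : Convex ℝ (apexCone b c) := by
  rintro x ⟨hx₀, hx₁, hxb, hxc⟩ y ⟨hy₀, hy₁, hyb, hyc⟩ s t hs ht hst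
  obtain rfl : t = 1 - s := by linarith
  simp only [apexCone, Set.mem_ofPred_eq, Prod.fst_add, Prod.snd_add, Prod.smul_fst, Prod.smul_snd,
    smul_eq_mul]
  have comb {u v : ℝ} (hu : 0 ≤ u) (hv : 0 ≤ v) : 0 ≤ s * u + (1 - s) * v := by positivity
  have h₁ := comb (sub_nonneg.2 hx₁) (sub_nonneg.2 hy₁)
  have hb := comb (sub_nonneg.2 hxb) (sub_nonneg.2 hyb)
  have hc := comb (sub_nonneg.2 hxc) (sub_nonneg.2 hyc)
  exact ⟨comb hx₀ hy₀, by linarith, by linarith, by linarith⟩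

theorem baseEdge_eq_segment (h : b ≤ c) :
    baseEdge b c = segment ℝ ((b, 0) : ℝ × ℝ) (c, 0) := by
  rw [← Prod.image_mk_segment_left, segment_eq_Icc h]
  ext ⟨x, y⟩
  simp [baseEdge, and_assoc, eq_comm (a := y)]

theorem baseEdge_self (b : ℝ) : baseEdge b b = {(b, 0)} := by
  rw [baseEdge_eq_segment le_rfl, segment_same]

theorem apexCone_subset (hV : Convex ℝ V) (hapex : ((0 : ℝ), (1 : ℝ)) ∈ V)
    (hb : (b, (0 : ℝ)) ∈ V) (hc : (c, (0 : ℝ)) ∈ V) : apexCone b c ⊆ V := by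
  rintro ⟨x, t⟩ ⟨ht₀, ht₁, hxb, hxc⟩
  simp only at ht₀ ht₁ hxb hxc
  rcases ht₁.lt_or_eq with ht | rfl
  · have ht' : 0 < 1 - t := sub_pos.2 ht
    have hbase : (x / (1 - t), (0 : ℝ)) ∈ V := by
      have hbx := (le_div_iff₀ ht').2 hxb
      have hxc := (div_le_iff₀ ht').2 hxc
      refine hV.segment_subset hb hc ?_
      rw [← baseEdge_eq_segment (hbx.trans hxc)]
      exact ⟨hbx, hxc, rfl⟩
    convert hV hbase hapex ht'.le ht₀ (by ring) using 1
    ext <;> simp [mul_div_cancel₀ _ ht'.ne']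
  · obtain rfl : x = 0 := by linarith
    exact hapex

theorem apexCone_self (b : ℝ) : apexCone b b = segment ℝ ((0, 1) : ℝ × ℝ) (b, 0) :=
  (apexCone_subset (convex_segment _ _) (left_mem_segment _ _ _) (right_mem_segment _ _ _)
    (right_mem_segment _ _ _)).antisymm
    ((convex_apexCone b b).segment_subset (apex_mem_apexCone b b) (base_mem_apexCone le_rfl le_rfl))

theorem convexHull_eq_baseEdge (hV : V ⊆ baseEdge b c) (hb : (b, (0 : ℝ)) ∈ V)
    (hc : (c, (0 : ℝ)) ∈ V) : convexHull ℝ V = baseEdge b c := by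
  have hbc : b ≤ c := (hV hb).2.1
  rw [baseEdge_eq_segment hbc] at hV ⊢
  exact (convexHull_min hV (convex_segment _ _)).antisymm (segment_subset_convexHull hb hc)

theorem convexHull_eq_apexCone (hV : V ⊆ apexCone b c) (hapex : ((0 : ℝ), (1 : ℝ)) ∈ V)
    (hb : (b, (0 : ℝ)) ∈ V) (hc : (c, (0 : ℝ)) ∈ V) : convexHull ℝ V = apexCone b c :=
  (convexHull_min hV (convex_apexCone b c)).antisymm
    (apexCone_subset (convex_convexHull ℝ V) (subset_convexHull ℝ V hapex)
      (subset_convexHull ℝ V hb) (subset_convexHull ℝ V hc))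

theorem affDim_baseEdge (h : b < c) : affDim (baseEdge b c) = 1 := by
  rw [baseEdge_eq_segment h.le]
  exact affDim_segment (by simpa using h.ne)

theorem affDim_apexCone_self (b : ℝ) : affDim (apexCone b b) = 1 := by
  rw [apexCone_self]
  exact affDim_segment (by simp)

theorem affDim_apexCone (h : b < c) : affDim (apexCone b c) = 2 := by
  rw [affDim_eq_two_iff_vectorSpan_eq_top, eq_top_iff]
  have hhor := vsub_mem_vectorSpan ℝ (base_mem_apexCone h.le le_rfl) (base_mem_apexCone le_rfl h.le)
  have hslant := vsub_mem_vectorSpan ℝ (apex_mem_apexCone b c) (base_mem_apexCone le_rfl h.le)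
  rintro ⟨x, y⟩ -
  convert add_mem (Submodule.smul_mem _ ((x + y * b) / (c - b)) hhor)
    (Submodule.smul_mem _ y hslant) using 1
  have := (sub_pos.2 h).ne'
  ext
  · simp
    field_simp
    ring
  · simp

theorem convexHull_cases_of_subset_apexSupport {T : Set ℝ} (hT : T.Finite)
    (hV : V ⊆ apexSupport T) (hne : V.Nonempty) :
    convexHull ℝ V = {((0 : ℝ), (1 : ℝ))} ∨ ∃ b ∈ T, ∃ c ∈ T, b ≤ c ∧
      (convexHull ℝ V = baseEdge b c ∨ convexHull ℝ V = apexCone b c) := by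
  let U : Set ℝ := {x ∈ T | (x, (0 : ℝ)) ∈ V}
  have hUV {p : ℝ × ℝ} (hp : p ∈ V) : p = (0, 1) ∨ ∃ x ∈ U, p = (x, 0) := by
    rcases hV hp with h | ⟨x, hx, rfl⟩
    exacts [.inl h, .inr ⟨x, ⟨hx, hp⟩, rfl⟩]
  rcases U.eq_empty_or_nonempty with hU | hU
  · left
    rw [(Set.eq_singleton_iff_nonempty_unique_mem.2 ⟨hne, fun p hp => ?_⟩ : V = {(0, 1)}),
      convexHull_singleton]
    simpa [hU] using hUV hp
  right
  have hUfin : U.Finite := hT.subset fun x hx => hx.1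
  obtain ⟨b, ⟨hbT, hbV⟩, hb⟩ := Set.exists_min_image U id hUfin hU
  obtain ⟨c, ⟨hcT, hcV⟩, hc⟩ := Set.exists_max_image U id hUfin hU
  refine ⟨b, hbT, c, hcT, hb c ⟨hcT, hcV⟩, ?_⟩
  by_cases hapex : ((0 : ℝ), (1 : ℝ)) ∈ V
  · refine .inr (convexHull_eq_apexCone (fun p hp => ?_) hapex hbV hcV)
    rcases hUV hp with rfl | ⟨x, hx, rfl⟩
    exacts [apex_mem_apexCone b c, base_mem_apexCone (hb x hx) (hc x hx)]
  · refine .inl (convexHull_eq_baseEdge (fun p hp => ?_) hbV hcV)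
    rcases hUV hp with rfl | ⟨x, hx, rfl⟩
    exacts [absurd hp hapex, ⟨hb x hx, hc x hx, rfl⟩]

end Polytopes

/-- The polytopes with vertices in `apexSupport T`, with their dimensions. -/
inductive IsSummand (T : Set ℝ) : Set (ℝ × ℝ) → ℕ → Prop
  | apex : IsSummand T {((0 : ℝ), (1 : ℝ))} 0
  | base {b : ℝ} : b ∈ T → IsSummand T {(b, (0 : ℝ))} 0
  | edge {b c : ℝ} : b ∈ T → c ∈ T → b < c → IsSummand T (baseEdge b c) 1
  | slant {b : ℝ} : b ∈ T → IsSummand T (apexCone b b) 1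
  | triangle {b c : ℝ} : b ∈ T → c ∈ T → b < c → IsSummand T (apexCone b c) 2

namespace IsSummand

variable {T : Set ℝ} {X : Set (ℝ × ℝ)}

theorem affDim_eq {d : ℕ} (h : IsSummand T X d) : affDim X = d := by
  cases h with
  | apex | base _ => exact affDim_singleton _
  | edge _ _ h => exact affDim_baseEdge h
  | slant _ => exact affDim_apexCone_self _
  | triangle _ _ h => exact affDim_apexCone h

theorem of_two (h : IsSummand T X 2) : ∃ b ∈ T, ∃ c ∈ T, b < c ∧ X = apexCone b c := by
  cases h with
  | triangle hb hc hbc => exact ⟨_, hb, _, hc, hbc, rfl⟩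

theorem of_one (h : IsSummand T X 1) :
    (∃ b ∈ T, ∃ c ∈ T, b < c ∧ X = baseEdge b c) ∨ ∃ b ∈ T, X = apexCone b b := by
  cases h with
  | edge hb hc hbc => exact .inl ⟨_, hb, _, hc, hbc, rfl⟩
  | slant hb => exact .inr ⟨_, hb, rfl⟩

theorem of_zero (h : IsSummand T X 0) :
    X = {((0 : ℝ), (1 : ℝ))} ∨ ∃ b ∈ T, X = {(b, (0 : ℝ))} := by
  cases h with
  | apex => exact .inl rfl
  | base hb => exact .inr ⟨_, hb, rfl⟩

end IsSummand

theorem isSummand_convexHull {T : Set ℝ} (hT : T.Finite) {V : Set (ℝ × ℝ)}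
    (hV : V ⊆ apexSupport T) (hne : V.Nonempty) :
    IsSummand T (convexHull ℝ V) (affDim (convexHull ℝ V)) := by
  have hdim : ∃ d, IsSummand T (convexHull ℝ V) d := by
    rcases convexHull_cases_of_subset_apexSupport hT hV hne with
      h | ⟨b, hb, c, hc, hbc, h | h⟩ <;> rw [h]
    · exact ⟨0, .apex⟩
    · rcases hbc.eq_or_lt with rfl | hbc
      · exact ⟨0, baseEdge_self b ▸ .base hb⟩
      · exact ⟨1, .edge hb hc hbc⟩
    · rcases hbc.eq_or_lt with rfl | hbc
      · exact ⟨1, .slant hb⟩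
      · exact ⟨2, .triangle hb hc hbc⟩
  obtain ⟨d, h⟩ := hdim
  rwa [h.affDim_eq]

/-- The exponents as real numbers. -/
def realSupport (B : Fin 3 → Finset ℕ) (i : Fin 3) : Set ℝ := (fun b : ℕ => (b : ℝ)) '' (B i)

theorem finite_realSupport (B : Fin 3 → Finset ℕ) (i : Fin 3) : (realSupport B i).Finite :=
  (B i).finite_toSet.image _

theorem curveSupports_eq_apexSupport (B : Fin 3 → Finset ℕ) (i : Fin 3) :
    curveSupports B i = apexSupport (realSupport B i) := by
  ext p
  simp [curveSupports, apexSupport, realSupport, eq_comm]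

theorem IsMinkowskiCell.isSummand {B : Fin 3 → Finset ℕ} {R : MinkowskiTriple}
    (h : IsMinkowskiCell (curveSupports B) R) (i : Fin 3) :
    IsSummand (realSupport B i) (R i) (affDim (R i)) := by
  obtain ⟨V, hV, hne, hR⟩ := h.1 i
  rw [hR]
  exact isSummand_convexHull (finite_realSupport B i) (curveSupports_eq_apexSupport B i ▸ hV) hne

theorem IsMinkowskiCell.convex_total {A R : MinkowskiTriple} (h : IsMinkowskiCell A R) :
    Convex ℝ R.total := by
  refine MinkowskiTriple.convex_total fun i => ?_
  obtain ⟨V, -, -, hV⟩ := h.1 i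
  exact hV ▸ convex_convexHull ℝ V

/-! ### The cells of a horizontal section -/

namespace SliceState

/-- The points of the three summands at the given position of the section at height `3 / 2`. -/
noncomputable def point (s : SliceState) (i : Fin 3) : ℝ × ℝ :=
  if i = s.a then (s.x, 0) else if i = s.b then (s.y / 2, 1 / 2) else (0, 1)

/-- The first coordinate of the position on the section. -/
noncomputable def pos (s : SliceState) : ℝ := s.x + s.y / 2

/-- The summands of the cell `R` contain the vertices which determine the position `s`. -/
structure LiesOn (s : SliceState) (R : MinkowskiTriple) : Prop where
  base_mem : (s.x, 0) ∈ R s.a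
  slant_subset : apexCone s.y s.y ⊆ R s.b
  apex_mem : (0, 1) ∈ R s.c

variable {s t : SliceState} {R : MinkowskiTriple}

theorem point_a (s : SliceState) : s.point s.a = (s.x, 0) := if_pos rfl

theorem point_b (h : IsLabelling s.a s.b s.c) : s.point s.b = (s.y / 2, 1 / 2) := by
  simp [point, h.ne₁₂.symm]

theorem point_c (h : IsLabelling s.a s.b s.c) : s.point s.c = (0, 1) := by
  simp [point, h.ne₁₃.symm, h.ne₂₃.symm]

theorem sum_point (h : IsLabelling s.a s.b s.c) : ∑ i, s.point i = (s.pos, 3 / 2) := by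
  rw [h.sum_eq, point_a, point_b h, point_c h]
  ext <;> norm_num [pos]

theorem LiesOn.point_mem (h : s.LiesOn R) (hl : IsLabelling s.a s.b s.c) (i : Fin 3) :
    s.point i ∈ R i := by
  rcases hl.eq_or i with rfl | rfl | rfl
  · exact point_a s ▸ h.base_mem
  · refine point_b hl ▸ h.slant_subset (mem_apexCone_self_iff.2 ?_)
    norm_num
    ring
  · exact point_c hl ▸ h.apex_mem

theorem LiesOn.mem_total (h : s.LiesOn R) (hl : IsLabelling s.a s.b s.c) :
    (s.pos, 3 / 2) ∈ R.total :=
  sum_point hl ▸ MinkowskiTriple.sum_mem_total (h.point_mem hl)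

theorem eq_of_point_eq (hs : IsLabelling s.a s.b s.c) (ht : IsLabelling t.a t.b t.c)
    (h : s.point = t.point) : s = t := by
  have hsa := (point_a s).symm.trans (congrFun h s.a)
  have hsb := (point_b hs).symm.trans (congrFun h s.b)
  have ha : s.a = t.a := by
    rcases ht.eq_or s.a with h | h | h
    · exact h
    · simp [h, point_b ht] at hsa
    · simp [h, point_c ht] at hsa
  have hb : s.b = t.b := by
    rcases ht.eq_or s.b with h | h | h
    · exact absurd (ha.trans h.symm) hs.ne₁₂
    · exact h
    · norm_num [h, point_c ht] at hsb
  have hc : s.c = t.c := by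
    rcases ht.eq_or s.c with h | h | h
    exacts [absurd (ha.trans h.symm) hs.ne₁₃, absurd (hb.trans h.symm) hs.ne₂₃, h]
  rw [ha, point_a, Prod.mk.injEq] at hsa
  rw [hb, point_b ht, Prod.mk.injEq] at hsb
  exact SliceState.ext ha hb hc hsa.1 (by linarith [hsb.1])

end SliceState

open SliceState

/-- The section at height `3 / 2` crosses the cell `R` from the position `s` to the position `t`. -/
structure IsCrossing (m M : Fin 3 → ℝ) (R : MinkowskiTriple) (s t : SliceState) : Prop where
  step : Step s t (contribution R)
  valid_left : s.Valid m M
  valid_right : t.Valid m M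
  left_liesOn : s.LiesOn R
  right_liesOn : t.LiesOn R
  pos_lt : s.pos < t.pos
  mem_Icc : ∀ x, (x, 3 / 2) ∈ R.total → x ∈ Set.Icc s.pos t.pos

/-- The cell does not meet the section and does not contribute to the exponents. -/
structure IsOffSection (R : MinkowskiTriple) : Prop where
  snd_ne : ∀ p ∈ R.total, p.2 ≠ 3 / 2
  contribution_eq_zero : contribution R = 0

section Cells

variable {m M : Fin 3 → ℝ} {R : MinkowskiTriple} {a b c : Fin 3} {x x' y y' z : ℝ}

theorem contribution_eq_zero_of_base (h : R a = {(x, (0 : ℝ))}) : contribution R = 0 := by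
  refine contribution_eq_zero fun i hi => ?_
  by_cases hia : i = a
  · rw [← hia, hi.1] at h
    simp at h
  · simpa [h, affDim_singleton] using hi.2 a (Ne.symm hia)

theorem contribution_eq_zero_of_triangle (h : affDim (R a) = 2) : contribution R = 0 := by
  refine contribution_eq_zero fun i hi => ?_
  by_cases hia : i = a
  · have hzero := hi.affDim_eq_zero
    rw [hia, h] at hzero
    exact two_ne_zero hzero
  · simpa [h] using hi.2 a (Ne.symm hia)

theorem isCrossing_moveMid (hl : IsLabelling a b c) (hx : x ∈ Set.Icc (m a) (M a))
    (hy : y ∈ Set.Icc (m b) (M b)) (hy' : y' ∈ Set.Icc (m b) (M b)) (h : y < y')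
    (ha : R a = {(x, 0)}) (hb : R b = apexCone y y') (hc : R c = {(0, 1)}) :
    IsCrossing m M R ⟨a, b, c, x, y⟩ ⟨a, b, c, x, y'⟩ where
  step := contribution_eq_zero_of_base ha ▸ .moveMid h.le
  valid_left := ⟨hl, hx, hy⟩
  valid_right := ⟨hl, hx, hy'⟩
  left_liesOn := ⟨by simp [ha], hb ▸ apexCone_subset (convex_apexCone _ _) (apex_mem_apexCone _ _)
    (base_mem_apexCone le_rfl h.le) (base_mem_apexCone le_rfl h.le), by simp [hc]⟩
  right_liesOn := ⟨by simp [ha], hb ▸ apexCone_subset (convex_apexCone _ _) (apex_mem_apexCone _ _)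
    (base_mem_apexCone h.le le_rfl) (base_mem_apexCone h.le le_rfl), by simp [hc]⟩
  pos_lt := by
    simp only [pos]
    linarith
  mem_Icc z hz := by
    rw [R.total_eq hl, ha, hb, hc] at hz
    obtain ⟨_, ⟨_, rfl, q, ⟨-, -, hql, hqr⟩, rfl⟩, _, rfl, hsum⟩ := hz
    obtain ⟨hfst, hsnd⟩ := Prod.ext_iff.1 hsum
    simp only [Prod.fst_add, Prod.snd_add] at hfst hsnd
    obtain hq : q.2 = 1 / 2 := by linarith
    rw [hq] at hql hqr
    constructor <;> simp only [pos] <;> linarith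

theorem isCrossing_moveLow (hl : IsLabelling a b c) (hx : x ∈ Set.Icc (m a) (M a))
    (hx' : x' ∈ Set.Icc (m a) (M a)) (hy : y ∈ Set.Icc (m b) (M b)) (h : x < x')
    (ha : R a = baseEdge x x') (hb : R b = apexCone y y) (hc : R c = {(0, 1)}) :
    IsCrossing m M R ⟨a, b, c, x, y⟩ ⟨a, b, c, x', y⟩ where
  step := by
    rw [contribution_eq_single hl (ha ▸ affDim_baseEdge h) (hb ▸ affDim_apexCone_self y) hc, ha, hb,
      baseEdge_eq_segment h.le, apexCone_self, volume_real_segment_add_segment]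
    simpa [abs_sub_comm x x', abs_of_pos (sub_pos.2 h)] using Step.moveLow h.le
  valid_left := ⟨hl, hx, hy⟩
  valid_right := ⟨hl, hx', hy⟩
  left_liesOn := ⟨by simp [ha, baseEdge, h.le], hb.ge, by simp [hc]⟩
  right_liesOn := ⟨by simp [ha, baseEdge, h.le], hb.ge, by simp [hc]⟩
  pos_lt := by
    simp only [pos]
    linarith
  mem_Icc z hz := by
    rw [R.total_eq hl, ha, hb, hc] at hz
    obtain ⟨_, ⟨p, ⟨hpl, hpr, hp⟩, q, hq, rfl⟩, _, rfl, hsum⟩ := hz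
    obtain ⟨hfst, hsnd⟩ := Prod.ext_iff.1 hsum
    simp only [Prod.fst_add, Prod.snd_add] at hfst hsnd
    obtain hq' : q.2 = 1 / 2 := by linarith
    have hq₁ := (mem_apexCone_self_iff.1 hq).2.2
    rw [hq'] at hq₁
    constructor <;> simp only [pos] <;> linarith

theorem isCrossing_swapLow (hl : IsLabelling a b c) (hx : x ∈ Set.Icc (m a) (M a))
    (hy : y ∈ Set.Icc (m b) (M b)) (h : x < y)
    (ha : R a = apexCone x x) (hb : R b = apexCone y y) (hc : R c = {(0, 1)}) :
    IsCrossing m M R ⟨a, b, c, x, y⟩ ⟨b, a, c, y, x⟩ where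
  step := by
    rw [contribution_eq_single hl (ha ▸ affDim_apexCone_self x) (hb ▸ affDim_apexCone_self y) hc,
      ha, hb, apexCone_self, apexCone_self, volume_real_segment_add_segment]
    convert Step.swapLow h.le using 2
    rw [← abs_of_pos (sub_pos.2 h)]
    congr 1
    ring
  valid_left := ⟨hl, hx, hy⟩
  valid_right := ⟨hl.swap₁₂, hy, hx⟩
  left_liesOn := ⟨by simp [ha, base_mem_apexCone], hb.ge, by simp [hc]⟩
  right_liesOn := ⟨by simp [hb, base_mem_apexCone], ha.ge, by simp [hc]⟩
  pos_lt := by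
    simp only [pos]
    linarith
  mem_Icc z hz := by
    rw [R.total_eq hl, ha, hb, hc] at hz
    obtain ⟨_, ⟨p, hp, q, hq, rfl⟩, _, rfl, hsum⟩ := hz
    obtain ⟨hp₀, -, hp⟩ := mem_apexCone_self_iff.1 hp
    obtain ⟨hq₀, -, hq⟩ := mem_apexCone_self_iff.1 hq
    obtain ⟨hfst, hsnd⟩ := Prod.ext_iff.1 hsum
    simp only [Prod.fst_add, Prod.snd_add] at hfst hsnd
    have hq₂ : q.2 = 1 / 2 - p.2 := by linarith
    rw [hq₂] at hq hq₀
    constructor <;> simp only [pos] <;> nlinarith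

theorem isCrossing_swapTop (hl : IsLabelling a b c) (hx : x ∈ Set.Icc (m a) (M a))
    (hy : y ∈ Set.Icc (m b) (M b)) (hz : z ∈ Set.Icc (m c) (M c)) (h : y < z)
    (ha : R a = {(x, 0)}) (hb : R b = apexCone y y) (hc : R c = apexCone z z) :
    IsCrossing m M R ⟨a, b, c, x, y⟩ ⟨a, c, b, x, z⟩ where
  step := contribution_eq_zero_of_base ha ▸ .swapTop h.le
  valid_left := ⟨hl, hx, hy⟩
  valid_right := ⟨hl.swap₂₃, hx, hz⟩
  left_liesOn := ⟨by simp [ha], hb.ge, by simp [hc, apex_mem_apexCone]⟩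
  right_liesOn := ⟨by simp [ha], hc.ge, by simp [hb, apex_mem_apexCone]⟩
  pos_lt := by
    simp only [pos]
    linarith
  mem_Icc z hz := by
    rw [R.total_eq hl, ha, hb, hc] at hz
    obtain ⟨_, ⟨_, rfl, p, hp, rfl⟩, q, hq, hsum⟩ := hz
    obtain ⟨-, hp₁, hp⟩ := mem_apexCone_self_iff.1 hp
    obtain ⟨-, hq₁, hq⟩ := mem_apexCone_self_iff.1 hq
    obtain ⟨hfst, hsnd⟩ := Prod.ext_iff.1 hsum
    simp only [Prod.fst_add, Prod.snd_add] at hfst hsnd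
    have hq₂ : q.2 = 3 / 2 - p.2 := by linarith
    rw [hq₂] at hq hq₁
    constructor <;> simp only [pos] <;> nlinarith

theorem isOffSection_triangle (hl : IsLabelling a b c) (hx : x < x') (ha : R a = apexCone x x')
    {u v : ℝ × ℝ} (hb : R b = {u}) (hc : R c = {v}) (h : u.2 + v.2 ≤ 0 ∨ 2 ≤ u.2 + v.2) :
    IsOffSection R where
  snd_ne p hp := by
    rw [R.total_eq hl, ha, hb, hc] at hp
    obtain ⟨_, ⟨q, ⟨hq₀, hq₁, -⟩, _, rfl, rfl⟩, _, rfl, rfl⟩ := hp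
    simp only [Prod.snd_add]
    rcases h with h | h <;> grind
  contribution_eq_zero := contribution_eq_zero_of_triangle (ha ▸ affDim_apexCone hx)

theorem isOffSection_edge_slant (hl : IsLabelling a b c) (ha : R a = {(x, 0)})
    (hb : R b = baseEdge y y') (hc : R c = apexCone z z) : IsOffSection R where
  snd_ne p hp := by
    rw [R.total_eq hl, ha, hb, hc] at hp
    obtain ⟨_, ⟨_, rfl, q, ⟨-, -, hq⟩, rfl⟩, r, ⟨-, hr, -⟩, rfl⟩ := hp
    simp only [Prod.snd_add, hq]
    grind
  contribution_eq_zero := contribution_eq_zero_of_base ha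

end Cells

section Classification

variable {T : Fin 3 → Set ℝ} {m M : Fin 3 → ℝ} {R : MinkowskiTriple} {i j k : Fin 3}

theorem exists_isLabelling_of_sum_eq_two {d : Fin 3 → ℕ} (h : ∑ i, d i = 2) :
    ∃ i j k, IsLabelling i j k ∧ (d i = 2 ∧ d j = 0 ∧ d k = 0 ∨ d i = 0 ∧ d j = 1 ∧ d k = 1) := by
  rw [Fin.sum_univ_three] at h
  have h₀ : IsLabelling 0 1 2 := ⟨by decide, by decide, by decide⟩
  by_cases hcase : d 0 = 2 ∨ (d 0 = 0 ∧ d 1 = 1)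
  · exact ⟨0, 1, 2, h₀, by omega⟩
  by_cases hcase' : d 1 = 2 ∨ (d 0 = 1 ∧ d 1 = 0)
  · exact ⟨1, 0, 2, h₀.swap₁₂, by omega⟩
  · exact ⟨2, 0, 1, h₀.swap₂₃.swap₁₂, by omega⟩

theorem exists_isCrossing_or_of_triangle (hT : ∀ i, T i ⊆ Set.Icc (m i) (M i))
    (hl : IsLabelling i j k) (hi : IsSummand (T i) (R i) 2) (hj : IsSummand (T j) (R j) 0)
    (hk : IsSummand (T k) (R k) 0) : (∃ s t, IsCrossing m M R s t) ∨ IsOffSection R := by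
  obtain ⟨x, hx, x', hx', hxx, Ri⟩ := hi.of_two
  rcases hj.of_zero with Rj | ⟨y, hy, Rj⟩ <;> rcases hk.of_zero with Rk | ⟨z, hz, Rk⟩
  · exact .inr (isOffSection_triangle hl hxx Ri Rj Rk (by norm_num))
  · exact .inl ⟨_, _, isCrossing_moveMid hl.swap₂₃.swap₁₂ (hT k hz) (hT i hx) (hT i hx') hxx
      Rk Ri Rj⟩
  · exact .inl ⟨_, _, isCrossing_moveMid hl.swap₁₂ (hT j hy) (hT i hx) (hT i hx') hxx Rj Ri Rk⟩
  · exact .inr (isOffSection_triangle hl hxx Ri Rj Rk (by norm_num))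

theorem exists_isCrossing_or_of_edge_slant (hT : ∀ i, T i ⊆ Set.Icc (m i) (M i))
    (hl : IsLabelling i j k) (hi : IsSummand (T i) (R i) 0) {y y' z : ℝ} (hy : y ∈ T j)
    (hy' : y' ∈ T j) (hyy : y < y') (hz : z ∈ T k) (Rj : R j = baseEdge y y')
    (Rk : R k = apexCone z z) : (∃ s t, IsCrossing m M R s t) ∨ IsOffSection R := by
  rcases hi.of_zero with Ri | ⟨x, -, Ri⟩
  · exact .inl ⟨_, _, isCrossing_moveLow hl.swap₁₂.swap₂₃ (hT j hy) (hT j hy') (hT k hz) hyy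
      Rj Rk Ri⟩
  · exact .inr (isOffSection_edge_slant hl Ri Rj Rk)

theorem exists_isCrossing_of_slant_slant (hT : ∀ i, T i ⊆ Set.Icc (m i) (M i))
    (hl : IsLabelling i j k) (hi : IsSummand (T i) (R i) 0) {y z : ℝ} (hy : y ∈ T j)
    (hz : z ∈ T k) (hyz : y < z) (Rj : R j = apexCone y y) (Rk : R k = apexCone z z) :
    ∃ s t, IsCrossing m M R s t := by
  rcases hi.of_zero with Ri | ⟨x, hx, Ri⟩
  · exact ⟨_, _, isCrossing_swapLow hl.swap₁₂.swap₂₃ (hT j hy) (hT k hz) hyz Rj Rk Ri⟩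
  · exact ⟨_, _, isCrossing_swapTop hl (hT i hx) (hT j hy) (hT k hz) hyz Ri Rj Rk⟩

theorem exists_isCrossing_or_of_segments (hT : ∀ i, T i ⊆ Set.Icc (m i) (M i))
    (hl : IsLabelling i j k) (hi : IsSummand (T i) (R i) 0) (hj : IsSummand (T j) (R j) 1)
    (hk : IsSummand (T k) (R k) 1) (h2 : affDim R.total = 2) :
    (∃ s t, IsCrossing m M R s t) ∨ IsOffSection R := by
  have eq_zero (f : ℝ × ℝ →ₗ[ℝ] ℝ) (hfj : ∀ p ∈ R j, ∀ q ∈ R j, f p = f q)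
      (hfk : ∀ p ∈ R k, ∀ q ∈ R k, f p = f q) : f = 0 := by
    refine R.eq_zero_of_affDim_total_eq_two h2 f (hl.forall_iff.2 ⟨?_, hfj, hfk⟩)
    rcases hi.of_zero with Ri | ⟨x, -, Ri⟩ <;> simp [Ri]
  rcases hj.of_one with ⟨y, hy, y', hy', hyy, Rj⟩ | ⟨y, hy, Rj⟩ <;>
    rcases hk.of_one with ⟨z, hz, z', hz', hzz, Rk⟩ | ⟨z, hz, Rk⟩
  · have hsnd := eq_zero (LinearMap.snd ℝ ℝ ℝ)
      (Rj ▸ fun p hp q hq => hp.2.2.trans hq.2.2.symm)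
      (Rk ▸ fun p hp q hq => hp.2.2.trans hq.2.2.symm)
    simpa using LinearMap.congr_fun hsnd (0, 1)
  · exact exists_isCrossing_or_of_edge_slant hT hl hi hy hy' hyy hz Rj Rk
  · exact exists_isCrossing_or_of_edge_slant hT hl.swap₂₃ hi hz hz' hzz hy Rk Rj
  · rcases lt_trichotomy y z with hyz | rfl | hyz
    · exact .inl (exists_isCrossing_of_slant_slant hT hl hi hy hz hyz Rj Rk)
    · have hslant : ∀ p ∈ apexCone y y, ∀ q ∈ apexCone y y, p.1 + y * p.2 = q.1 + y * q.2 := by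
        intro p hp q hq
        linarith [(mem_apexCone_self_iff.1 hp).2.2, (mem_apexCone_self_iff.1 hq).2.2]
      have hzero := eq_zero (LinearMap.fst ℝ ℝ ℝ + y • LinearMap.snd ℝ ℝ ℝ)
        (by simpa [Rj] using hslant) (by simpa [Rk] using hslant)
      simpa using LinearMap.congr_fun hzero (1, 0)
    · exact .inl (exists_isCrossing_of_slant_slant hT hl.swap₂₃ hi hz hy hyz Rk Rj)

theorem exists_isCrossing_or_isOffSection (hT : ∀ i, T i ⊆ Set.Icc (m i) (M i))
    (hR : ∀ i, IsSummand (T i) (R i) (affDim (R i))) (h2 : affDim R.total = 2)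
    (hd : ∑ i, affDim (R i) = 2) : (∃ s t, IsCrossing m M R s t) ∨ IsOffSection R := by
  obtain ⟨i, j, k, hl, ⟨hi, hj, hk⟩ | ⟨hi, hj, hk⟩⟩ := exists_isLabelling_of_sum_eq_two hd
  · exact exists_isCrossing_or_of_triangle hT hl (hi ▸ hR i) (hj ▸ hR j) (hk ▸ hR k)
  · exact exists_isCrossing_or_of_segments hT hl (hi ▸ hR i) (hj ▸ hR j) (hk ▸ hR k) h2

end Classification

/-! ### Gluing the cells along the section -/

section Intervals

variable {ι α : Type*} [LinearOrder α] {F : Finset ι} {l r : ι → α}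

theorem exists_right_eq_left_of_cover [DenselyOrdered α]
    (hdisj : ∀ i ∈ F, ∀ j ∈ F, max (l i) (l j) < min (r i) (r j) → i = j)
    (hcov : ∀ i ∈ F, ∀ j ∈ F, ∀ x ∈ Set.Icc (l i) (l j), ∃ k ∈ F, x ∈ Set.Icc (l k) (r k))
    {i j : ι} (hi : i ∈ F) (hj : j ∈ F) (hij : l i < l j) (hlr : l j < r j) :
    ∃ k ∈ F, r k = l j := by
  classical
  let ends : Finset α := insert (l i) {y ∈ F.image r | y < l j}
  have hends : ∀ y ∈ ends, y < l j := by simp [ends, hij]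
  obtain ⟨x, hx, hxj⟩ := exists_between
    ((ends.max'_lt_iff ⟨l i, Finset.mem_insert_self _ _⟩).2 hends)
  have hx : ∀ y ∈ ends, y < x := (ends.max'_lt_iff _).1 hx
  obtain ⟨k, hk, hlk, hrk⟩ := hcov i hi j hj x ⟨(hx _ (Finset.mem_insert_self _ _)).le, hxj.le⟩
  refine ⟨k, hk, eq_of_le_of_not_lt (le_of_not_gt fun hlt => ?_) fun hlt => ?_⟩
  · obtain rfl := hdisj k hk j hj <| by
      rw [max_eq_right (hlk.trans hxj.le)]
      exact lt_min hlt hlr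
    exact (hlk.trans_lt hxj).false
  · refine (hx (r k) ?_).not_ge hrk
    simp only [ends, Finset.mem_insert, Finset.mem_filter]
    exact .inr ⟨Finset.mem_image_of_mem r hk, hlt⟩

theorem interval_chain_induction [DenselyOrdered α] [DecidableEq ι] {P : ι → Finset ι → Prop}
    (hlr : ∀ i ∈ F, l i < r i)
    (hdisj : ∀ i ∈ F, ∀ j ∈ F, max (l i) (l j) < min (r i) (r j) → i = j)
    (hcov : ∀ i ∈ F, ∀ j ∈ F, ∀ x ∈ Set.Icc (l i) (l j), ∃ k ∈ F, x ∈ Set.Icc (l k) (r k))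
    (first : ∀ i ∈ F, (∀ j ∈ F, l i ≤ l j) → P i {i})
    (next : ∀ i ∈ F, ∀ j ∈ F, r j = l i → ∀ G, i ∉ G → P j G → P i (insert i G))
    {i : ι} (hi : i ∈ F) (hmax : ∀ j ∈ F, r j ≤ r i) : P i F := by
  suffices h : ∀ i ∈ F, P i {j ∈ F | r j ≤ r i} by
    simpa only [Finset.filter_true_of_mem hmax] using h i hi
  intro i hi
  refine (F.finite_toSet.wellFoundedOn (r := fun i j => r i < r j)).induction
    (P := fun i => P i {j ∈ F | r j ≤ r i}) hi fun i hi ih => ?_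
  have eq_of_lt : ∀ k ∈ F, r k ≤ r i → l i < r k → k = i := fun k hk hki hik =>
    hdisj k hk i hi (by
      rw [min_eq_left hki]
      exact max_lt (hlr k hk) hik)
  by_cases hfirst : ∀ j ∈ F, l i ≤ l j
  · convert first i hi hfirst
    ext k
    simp only [Finset.mem_filter, Finset.mem_singleton]
    refine ⟨fun ⟨hk, hki⟩ => eq_of_lt k hk hki ((hfirst k hk).trans_lt (hlr k hk)), ?_⟩
    rintro rfl
    exact ⟨hi, le_rfl⟩
  · push Not at hfirst
    obtain ⟨k, hk, hki⟩ := hfirst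
    obtain ⟨j, hj, hji⟩ := exists_right_eq_left_of_cover hdisj hcov hk hi hki (hlr i hi)
    have hlt : r j < r i := hji ▸ hlr i hi
    convert next i hi j hj hji _ (by simp [hlt]) (ih j hj hlt)
    ext k
    simp only [Finset.mem_filter, Finset.mem_insert]
    constructor
    · exact fun ⟨hk, hki⟩ => or_iff_not_imp_right.2 fun hkj =>
        eq_of_lt k hk hki (by grind)
    · grind

end Intervals

section Gluing

variable {m M : Fin 3 → ℝ} {F R R' : MinkowskiTriple} {s t s' t' : SliceState}

theorem SliceState.LiesOn.top_mem_total (h : s.LiesOn R) (hl : IsLabelling s.a s.b s.c) :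
    (s.x, 2) ∈ R.total := by
  rw [R.total_eq hl]
  refine ⟨_, Set.add_mem_add h.base_mem (h.slant_subset (apex_mem_apexCone _ _)), _, h.apex_mem, ?_⟩
  ext <;> norm_num

theorem SliceState.LiesOn.bottom_mem_total (h : s.LiesOn R) (hl : IsLabelling s.a s.b s.c) :
    (s.x + s.y, 1) ∈ R.total := by
  rw [R.total_eq hl]
  refine ⟨_, Set.add_mem_add h.base_mem (h.slant_subset (base_mem_apexCone le_rfl le_rfl)), _,
    h.apex_mem, ?_⟩
  ext <;> norm_num

theorem IsCrossing.mem_total (h : IsCrossing m M R s t) (hc : Convex ℝ R.total) {x : ℝ}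
    (hx : x ∈ Set.Icc s.pos t.pos) : (x, 3 / 2) ∈ R.total := by
  apply hc.segment_subset (h.left_liesOn.mem_total h.valid_left.isLabelling)
    (h.right_liesOn.mem_total h.valid_right.isLabelling)
  rw [← Prod.image_mk_segment_left, segment_eq_Icc h.pos_lt.le]
  exact Set.mem_image_of_mem _ hx

theorem IsCrossing.eq_zero_of_forall_le (h : IsCrossing m M R s t) {x : ℝ}
    (hx : x ∈ Set.Ioo s.pos t.pos) {l : (ℝ × ℝ) →L[ℝ] ℝ}
    (hl : ∀ p ∈ R.total, l p ≤ l (x, 3 / 2)) : l = 0 := by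
  have hleft := hl _ (h.left_liesOn.mem_total h.valid_left.isLabelling)
  have hright := hl _ (h.right_liesOn.mem_total h.valid_right.isLabelling)
  have htop := hl _ (h.left_liesOn.top_mem_total h.valid_left.isLabelling)
  have hbottom := hl _ (h.left_liesOn.bottom_mem_total h.valid_left.isLabelling)
  rw [linear_apply_prod, linear_apply_prod l (x, _)] at hleft hright htop hbottom
  have hfst : l (1, 0) = 0 := by
    rcases lt_trichotomy (l (1, 0)) 0 with hneg | hzero | hpos
    exacts [by nlinarith [hx.1], hzero, by nlinarith [hx.2]]
  rw [hfst] at htop hbottom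
  have hsnd : l (0, 1) = 0 := by linarith
  ext <;> simp [hfst, hsnd]

theorem MinkowskiTriple.IsFace.eq_of_mem_Ioo (hF : F.IsFace R) (h : IsCrossing m M R s t) {x : ℝ}
    (hx : x ∈ Set.Ioo s.pos t.pos) (hxF : (x, 3 / 2) ∈ F.total) : F = R := by
  obtain ⟨l, hl⟩ := hF
  have hmax : ∀ p ∈ R.total, l p ≤ l (x, 3 / 2) := by
    intro p hp
    obtain ⟨q, hq, rfl⟩ := MinkowskiTriple.mem_total.1 hp
    obtain ⟨q', hq', hsum⟩ := MinkowskiTriple.mem_total.1 hxF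
    rw [← hsum, map_sum, map_sum]
    exact Finset.sum_le_sum fun i _ => (hl i ▸ hq' i).2 _ (hq i)
  obtain rfl := h.eq_zero_of_forall_le hx hmax
  funext i
  simp [hl i, ContinuousLinearMap.toExposed]

theorem IsCrossing.eq_of_overlap (h : IsCrossing m M R s t) (h' : IsCrossing m M R' s' t')
    (hc : Convex ℝ R.total) (hc' : Convex ℝ R'.total) (hR : IntersectProperly R R')
    (hlt : max s.pos s'.pos < min t.pos t'.pos) : R = R' := by
  obtain ⟨x, hx₁, hx₂⟩ := exists_between hlt
  rw [max_lt_iff] at hx₁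
  rw [lt_min_iff] at hx₂
  have hx : (x, 3 / 2) ∈ R.total := h.mem_total hc ⟨hx₁.1.le, hx₂.1.le⟩
  have hx' : (x, 3 / 2) ∈ R'.total := h'.mem_total hc' ⟨hx₁.2.le, hx₂.2.le⟩
  obtain ⟨F, hF, hF', hFt⟩ := hR.2 ⟨_, hx, hx'⟩
  have hxF : (x, 3 / 2) ∈ F.total := hFt ▸ ⟨hx, hx'⟩
  rw [← hF.eq_of_mem_Ioo h ⟨hx₁.1, hx₂.1⟩ hxF, hF'.eq_of_mem_Ioo h' ⟨hx₁.2, hx₂.2⟩ hxF]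

theorem IntersectProperly.eq_of_sum_eq (h : IntersectProperly R R')
    (hR : ∑ i, affDim (R i) ≤ affDim R.total) (hR' : ∑ i, affDim (R' i) ≤ affDim R'.total)
    {q q' : Fin 3 → ℝ × ℝ} (hq : ∀ i, q i ∈ R i) (hq' : ∀ i, q' i ∈ R' i)
    (hs : ∑ i, q i = ∑ i, q' i) : q = q' := by
  have hmem : ∑ i, q i ∈ R.total := MinkowskiTriple.sum_mem_total hq
  have hmem' : ∑ i, q i ∈ R'.total := hs ▸ MinkowskiTriple.sum_mem_total hq'
  obtain ⟨F, hF, hF', hFt⟩ := h.2 ⟨_, hmem, hmem'⟩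
  have hmemF : ∑ i, q i ∈ F.total := hFt ▸ ⟨hmem, hmem'⟩
  obtain ⟨r, hr, hsum⟩ := MinkowskiTriple.mem_total.1 hmemF
  exact (MinkowskiTriple.sum_injOn hR hq (fun i => hF.subset i (hr i)) hsum.symm).trans
    (MinkowskiTriple.sum_injOn hR' hq' (fun i => hF'.subset i (hr i)) (hsum.trans hs).symm).symm

theorem SliceState.LiesOn.eq_of_pos_eq (h : s.LiesOn R) (h' : t.LiesOn R')
    (hl : IsLabelling s.a s.b s.c) (hl' : IsLabelling t.a t.b t.c) (hRR : IntersectProperly R R')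
    (hR : ∑ i, affDim (R i) ≤ affDim R.total) (hR' : ∑ i, affDim (R' i) ≤ affDim R'.total)
    (hpos : s.pos = t.pos) : s = t :=
  eq_of_point_eq hl hl' <| hRR.eq_of_sum_eq hR hR' (h.point_mem hl) (h'.point_mem hl') <| by
    rw [sum_point hl, sum_point hl', hpos]

end Gluing

section Path

variable {B : Fin 3 → Finset ℕ} {S : Finset MinkowskiTriple} {m M : Fin 3 → ℝ} {s : SliceState}

theorem base_slant_mem {i j : Fin 3} (hij : i ≠ j) {x y : ℝ} (hx : x ∈ realSupport B i)
    (hy : y ∈ realSupport B j) :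
    (x + y / 2, 3 / 2) ∈ MinkowskiTriple.total (fun i => convexHull ℝ (curveSupports B i)) := by
  obtain ⟨k, hl⟩ : ∃ k, IsLabelling i j k := by
    obtain ⟨k, hik, hjk⟩ := (by decide : ∀ i j : Fin 3, ∃ k, i ≠ k ∧ j ≠ k) i j
    exact ⟨k, hij, hik, hjk⟩
  have apex (l) : (0, 1) ∈ convexHull ℝ (curveSupports B l) :=
    subset_convexHull _ _ (curveSupports_eq_apexSupport B l ▸ .inl rfl)
  have base (l) {x} (hx : x ∈ realSupport B l) : (x, 0) ∈ convexHull ℝ (curveSupports B l) :=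
    subset_convexHull _ _ (curveSupports_eq_apexSupport B l ▸ .inr ⟨x, hx, rfl⟩)
  let p : SliceState := ⟨i, j, k, x, y⟩
  exact (⟨base i hx, apexCone_subset (convex_convexHull ℝ _) (apex j) (base j hy) (base j hy),
    apex k⟩ : p.LiesOn _).mem_total hl

theorem SliceState.Valid.x_le_of_pos_le (hs : s.Valid m M)
    (h : ∀ i j, i ≠ j → s.pos ≤ m i + m j / 2) (i : Fin 3) : s.x ≤ m i := by
  have hl := hs.isLabelling
  have hab := h s.a s.b hl.ne₁₂
  have hba := h s.b s.a hl.ne₁₂.symm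
  have hcb := h s.c s.b hl.ne₂₃.symm
  have hx := hs.mem_a.1
  have hy := hs.mem_b.1
  simp only [pos] at hab hba hcb
  rcases hl.eq_or i with rfl | rfl | rfl <;> linarith

theorem SliceState.Valid.le_x_of_le_pos (hs : s.Valid m M)
    (h : ∀ i j, i ≠ j → M i + M j / 2 ≤ s.pos) (i : Fin 3) : M i ≤ s.x := by
  refine neg_le_neg_iff.1 (hs.reflect.x_le_of_pos_le (fun i j hij => ?_) i)
  have hpos := h i j hij
  simp only [pos, SliceState.reflect, Pi.neg_apply] at hpos ⊢
  linarith

theorem IsTightMixedSubdivision.exists_crossings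
    (hS : IsTightMixedSubdivision (curveSupports B) S)
    (hB : ∀ i, realSupport B i ⊆ Set.Icc (m i) (M i)) :
    ∃ C ⊆ S, ∃ s t : MinkowskiTriple → SliceState, (∀ R ∈ C, IsCrossing m M R (s R) (t R)) ∧
      ∑ R ∈ C, contribution R = mixedExponent S ∧
      ∀ x, (x, 3 / 2) ∈ MinkowskiTriple.total (fun i => convexHull ℝ (curveSupports B i)) →
        ∃ R ∈ C, x ∈ Set.Icc (s R).pos (t R).pos := by
  classical
  obtain ⟨⟨hcell, hcover, -⟩, htight⟩ := hS
  let C : Finset MinkowskiTriple := {R ∈ S | ∃ s t, IsCrossing m M R s t}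
  have hoff : ∀ R ∈ S, R ∉ C → IsOffSection R := fun R hR hRC =>
    (exists_isCrossing_or_isOffSection hB (hcell R hR).isSummand (hcell R hR).2
      (htight R hR)).resolve_left fun h => hRC (Finset.mem_filter.2 ⟨hR, h⟩)
  have hstates : ∀ R, ∃ s t, R ∈ C → IsCrossing m M R s t := by
    intro R
    by_cases hR : R ∈ C
    · obtain ⟨s, t, h⟩ := (Finset.mem_filter.1 hR).2
      exact ⟨s, t, fun _ => h⟩
    · exact ⟨⟨0, 0, 0, 0, 0⟩, ⟨0, 0, 0, 0, 0⟩, fun h => absurd h hR⟩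
  choose s t hst using hstates
  refine ⟨C, Finset.filter_subset _ _, s, t, hst, ?_, fun x hx => ?_⟩
  · rw [mixedExponent_eq_sum]
    exact Finset.sum_subset (Finset.filter_subset _ _) fun R hR hRC =>
      (hoff R hR hRC).contribution_eq_zero
  · obtain ⟨R, hR, hxR⟩ := Set.mem_iUnion₂.1 (hcover ▸ hx)
    have hRC : R ∈ C := by_contra fun hRC => (hoff R hR hRC).snd_ne _ hxR rfl
    exact ⟨R, hRC, (hst R hRC).mem_Icc x hxR⟩

theorem path_of_crossings {C : Finset MinkowskiTriple} {s t : MinkowskiTriple → SliceState}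
    (hC : ∀ R ∈ C, IsCrossing m M R (s R) (t R))
    (hdisj : ∀ R ∈ C, ∀ R' ∈ C,
      max (s R).pos (s R').pos < min (t R).pos (t R').pos → R = R')
    (hcov : ∀ R ∈ C, ∀ R' ∈ C, ∀ x ∈ Set.Icc (s R).pos (s R').pos,
      ∃ Q ∈ C, x ∈ Set.Icc (s Q).pos (t Q).pos)
    (hss : ∀ R ∈ C, ∀ R' ∈ C, (s R).pos = (s R').pos → s R = s R')
    (hts : ∀ R ∈ C, ∀ R' ∈ C, (t R).pos = (s R').pos → t R = s R')
    {first last : MinkowskiTriple} (hfirst : first ∈ C) (hlast : last ∈ C)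
    (hmin : ∀ R ∈ C, (s first).pos ≤ (s R).pos) (hmax : ∀ R ∈ C, (t R).pos ≤ (t last).pos) :
    Path m M (s first) (t last) (∑ R ∈ C, contribution R) := by
  classical
  refine interval_chain_induction (l := fun R => (s R).pos) (r := fun R => (t R).pos)
    (P := fun R G => Path m M (s first) (t R) (∑ R ∈ G, contribution R))
    (fun R hR => (hC R hR).pos_lt) hdisj hcov (fun R hR hRmin => ?_)
    (fun R hR R' hR' hRR' G hG ih => ?_) hlast hmax
  · rw [Finset.sum_singleton, ← zero_add (contribution R),
      hss first hfirst R hR (le_antisymm (hmin R hR) (hRmin first hfirst))]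
    exact .snoc (.refl (hC R hR).valid_left) (hC R hR).step (hC R hR).valid_right
  · rw [Finset.sum_insert hG, add_comm]
    exact ih.snoc (hts R' hR' R hR hRR' ▸ (hC R hR).step) (hC R hR).valid_right

theorem IsTightMixedSubdivision.exists_path
    (hS : IsTightMixedSubdivision (curveSupports B) S)
    (hm : ∀ i, IsLeast (realSupport B i) (m i)) (hM : ∀ i, IsGreatest (realSupport B i) (M i)) :
    ∃ s t, Path m M s t (mixedExponent S) ∧ (∀ i, s.x ≤ m i) ∧ ∀ i, M i ≤ t.x := by
  obtain ⟨C, hCS, s, t, hC, hsum, hcov⟩ :=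
    hS.exists_crossings fun i x hx => ⟨(hm i).2 hx, (hM i).2 hx⟩
  obtain ⟨⟨hcell, hcover, hprop⟩, htight⟩ := hS
  have hconv (R) (hR : R ∈ C) : Convex ℝ R.total := (hcell R (hCS hR)).convex_total
  have hdim (R) (hR : R ∈ C) : ∑ i, affDim (R i) ≤ affDim R.total :=
    ((htight R (hCS hR)).trans (hcell R (hCS hR)).2.symm).le
  have hproper {R R'} (hR : R ∈ C) (hR' : R' ∈ C) := hprop R (hCS hR) R' (hCS hR')
  have hleft (R) (hR : R ∈ C) := hcover ▸ Set.mem_iUnion₂_of_mem (hCS hR)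
    ((hC R hR).left_liesOn.mem_total (hC R hR).valid_left.isLabelling)
  obtain ⟨R₀, hR₀, -⟩ := hcov _ (base_slant_mem (show (0 : Fin 3) ≠ 1 by decide) (hm 0).1 (hm 1).1)
  obtain ⟨first, hfirst, hmin⟩ := C.exists_min_image (fun R => (s R).pos) ⟨R₀, hR₀⟩
  obtain ⟨last, hlast, hmax⟩ := C.exists_max_image (fun R => (t R).pos) ⟨R₀, hR₀⟩
  refine ⟨s first, t last, hsum ▸ path_of_crossings hC
    (fun R hR R' hR' => (hC R hR).eq_of_overlap (hC R' hR') (hconv R hR) (hconv R' hR')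
      (hproper hR hR'))
    (fun R hR R' hR' x hx => hcov x ?_)
    (fun R hR R' hR' => (hC R hR).left_liesOn.eq_of_pos_eq (hC R' hR').left_liesOn
      (hC R hR).valid_left.isLabelling (hC R' hR').valid_left.isLabelling (hproper hR hR')
      (hdim R hR) (hdim R' hR'))
    (fun R hR R' hR' => (hC R hR).right_liesOn.eq_of_pos_eq (hC R' hR').left_liesOn
      (hC R hR).valid_right.isLabelling (hC R' hR').valid_left.isLabelling (hproper hR hR')
      (hdim R hR) (hdim R' hR')) hfirst hlast hmin hmax,
    (hC first hfirst).valid_left.x_le_of_pos_le fun i j hij => ?_,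
    (hC last hlast).valid_right.le_x_of_le_pos fun i j hij => ?_⟩
  · apply (MinkowskiTriple.convex_total fun i => convex_convexHull ℝ _).segment_subset
      (hleft R hR) (hleft R' hR')
    rw [← Prod.image_mk_segment_left, segment_eq_Icc (hx.1.trans hx.2)]
    exact Set.mem_image_of_mem _ hx
  · obtain ⟨R, hR, hRx, -⟩ := hcov _ (base_slant_mem hij (hm i).1 (hm j).1)
    exact (hmin R hR).trans hRx
  · obtain ⟨R, hR, -, hRx⟩ := hcov _ (base_slant_mem hij (hM i).1 (hM j).1)
    exact hRx.trans (hmax R hR)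

end Path

/-! ### Subdivisions induced by linear liftings -/

section Duality

variable {E F : Type*} [AddCommGroup E] [Module ℝ E] [TopologicalSpace E]

theorem toExposed_convexHull (f : StrongDual ℝ E) (X : Set E) :
    f.toExposed (convexHull ℝ X) = convexHull ℝ (f.toExposed X) := by
  apply Set.Subset.antisymm
  · rintro x ⟨hx, hmax⟩
    obtain ⟨ι, _, w, z, hw, hw₁, hz, rfl⟩ := mem_convexHull_iff_exists_fintype.1 hx
    have hle (i : ι) : f (z i) ≤ f (∑ i, w i • z i) := hmax _ (subset_convexHull ℝ X (hz i))
    have hsum : ∑ i, w i * (f (∑ i, w i • z i) - f (z i)) = 0 := by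
      simp only [mul_sub, Finset.sum_sub_distrib, ← Finset.sum_mul, hw₁, one_mul, map_sum, map_smul,
        smul_eq_mul, sub_self]
    have hzero := (Finset.sum_eq_zero_iff_of_nonneg fun i _ =>
      mul_nonneg (hw i) (sub_nonneg.2 (hle i))).1 hsum
    rw [← Finset.centerMass_eq_of_sum_1 _ _ hw₁, ← Finset.centerMass_filter_ne_zero]
    refine Finset.centerMass_mem_convexHull _ (fun i _ => hw i) ?_
      fun i hi => ⟨hz i, fun y hy => ?_⟩
    · rw [Finset.sum_filter_ne_zero, hw₁]
      exact one_pos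
    · have := (mul_eq_zero.1 (hzero i (Finset.mem_univ i))).resolve_left (Finset.mem_filter.1 hi).2
      exact (hmax y (subset_convexHull ℝ X hy)).trans (sub_eq_zero.1 this).le
  · refine fun x hx => ⟨convexHull_mono (fun a ha => ha.1) hx, fun y hy => ?_⟩
    obtain ⟨z, hz⟩ : (f.toExposed X).Nonempty := convexHull_nonempty_iff.1 ⟨x, hx⟩
    have hyz : f y ≤ f z :=
      convexHull_min (fun a ha => hz.2 a ha) (convex_halfSpace_le f.isLinear (f z)) hy
    have hzx : f z ≤ f x :=
      convexHull_min (fun a ha => ha.2 z hz.1) (convex_halfSpace_ge f.isLinear (f z)) hx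
    exact hyz.trans hzx

variable [IsTopologicalAddGroup E] [ContinuousSMul ℝ E]

theorem exists_nonvertical_support {G : Set (E × ℝ)} (hG : Convex ℝ G) {p : E} {c d : ℝ}
    (hcd : c < d) (hc : (p, c) ∉ interior G) (hd : (p, d) ∈ interior G) :
    ∃ l : StrongDual ℝ E, ∀ z ∈ G, l p + c ≤ l z.1 + z.2 := by
  obtain ⟨f, hf₀, hf⟩ := geometric_hahn_banach_of_nonempty_interior_point hG hc ⟨_, hd⟩
  have hlt : f (p, d) < f (p, c) := by
    have hsub : f '' G ⊆ Set.Iic (f (p, c)) := Set.image_subset_iff.2 fun z hz => hf z hz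
    rw [← Set.mem_Iio, ← interior_Iic]
    exact interior_mono hsub
      ((f.isOpenMap_of_ne_zero hf₀).image_interior_subset _ (Set.mem_image_of_mem f hd))
  have hf_apply (x : E) (g : ℝ) : f (x, g) = f (x, 0) + f (0, 1) * g := by
    rw [← smul_eq_mul, smul_eq_mul, mul_comm, ← smul_eq_mul, ← map_smul, ← map_add]
    simp
  have hneg : f (0, 1) < 0 := by
    rw [hf_apply, hf_apply _ c] at hlt
    nlinarith
  refine ⟨(f (0, 1))⁻¹ • f.comp (.inl ℝ E ℝ), fun z hz => ?_⟩
  have hle := hf z hz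
  rw [← z.eta, hf_apply, hf_apply _ c] at hle
  have := mul_le_mul_of_nonpos_left hle (inv_nonpos.2 hneg.le)
  simpa [mul_add, inv_mul_cancel_left₀ hneg.ne] using this

variable [T1Space E] [AddCommGroup F] [Module ℝ F] [TopologicalSpace F] {K : Set F}

/-- `l` is the Lagrange multiplier of the constraint `T q = p`: it supports the image of the
epigraph of `φ` at its lowest point above `p`. -/
theorem exists_isMinOn_comp_add (hK : IsCompact K) (hKc : Convex ℝ K) (T : F →L[ℝ] E)
    (φ : StrongDual ℝ F) {p : E} (hp : p ∈ interior (T '' K)) :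
    ∃ q ∈ K, T q = p ∧ ∃ l : StrongDual ℝ E, IsMinOn (fun r => l (T r) + φ r) K q := by
  have hfib : (K ∩ T ⁻¹' {p}).Nonempty := by
    obtain ⟨r, hr⟩ := interior_subset hp
    exact ⟨r, hr⟩
  obtain ⟨q, ⟨hqK, hqp⟩, hmin⟩ := (hK.inter_right
    (isClosed_singleton.preimage T.continuous)).exists_isMinOn hfib φ.continuous.continuousOn
  obtain ⟨Ω, hΩ⟩ := hK.bddAbove_image φ.continuous.continuousOn
  replace hΩ (r) (hr : r ∈ K) : φ r ≤ Ω := hΩ (Set.mem_image_of_mem φ hr)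
  let G : Set (E × ℝ) := T.prodMap (.id ℝ ℝ) '' {z | z.1 ∈ K ∧ φ z.1 ≤ z.2}
  have mem_G {r : F} {g : ℝ} (hr : r ∈ K) (hg : φ r ≤ g) : (T r, g) ∈ G :=
    ⟨(r, g), ⟨hr, hg⟩, rfl⟩
  have hG : Convex ℝ G :=
    ((φ : F →ₗ[ℝ] ℝ).convexOn hKc).convex_epigraph.linear_image (T.prodMap (.id ℝ ℝ)).toLinearMap
  have hhigh : (p, Ω + 1) ∈ interior G := by
    rw [mem_interior_iff_mem_nhds] at hp ⊢
    filter_upwards [prod_mem_nhds hp (Ioi_mem_nhds (lt_add_one Ω))]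
    rintro ⟨_, g⟩ ⟨⟨r, hr, rfl⟩, hg⟩
    exact mem_G hr ((hΩ r hr).trans hg.le)
  have hlow : (p, φ q) ∉ interior G := fun h => by
    have hsub : Prod.mk p ⁻¹' G ⊆ Set.Ici (φ q) := by
      rintro _ ⟨⟨r, g⟩, ⟨hr, hrg⟩, h⟩
      obtain ⟨hTr, rfl⟩ := Prod.mk_inj.1 h
      exact (hmin ⟨hr, hTr⟩).trans hrg
    have hmem := interior_mono hsub
      (preimage_interior_subset_interior_preimage (Continuous.prodMk_right p) h)
    rw [interior_Ici] at hmem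
    exact lt_irrefl _ (Set.mem_Ioi.1 hmem)
  obtain ⟨l, hl⟩ := exists_nonvertical_support hG (by linarith [hΩ q hqK]) hlow hhigh
  refine ⟨q, hqK, hqp, l, fun r hr => ?_⟩
  simpa [show T q = p from hqp] using hl _ (mem_G hr le_rfl)

end Duality

section LinearLifting

variable {A : MinkowskiTriple} {ω : Fin 3 → ((ℝ × ℝ) →ₗ[ℝ] ℝ)} {l l' : (ℝ × ℝ) →L[ℝ] ℝ} {i : Fin 3}

theorem lowerFace_eq_toExposed : lowerFace A (fun i => ω i) l i =
    (-(l + LinearMap.toContinuousLinearMap (ω i))).toExposed (convexHull ℝ (A i)) := by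
  have hle (x y : ℝ × ℝ) : (-(l + LinearMap.toContinuousLinearMap (ω i))) x ≤
      (-(l + LinearMap.toContinuousLinearMap (ω i))) y ↔ l y + ω i y ≤ l x + ω i x :=
    neg_le_neg_iff
  rw [toExposed_convexHull]
  simp only [lowerFace, ContinuousLinearMap.toExposed, hle]

theorem mem_lowerFace {x : ℝ × ℝ} :
    x ∈ lowerFace A (fun i => ω i) l i ↔ x ∈ convexHull ℝ (A i) ∧
      ∀ y ∈ convexHull ℝ (A i), l x + ω i x ≤ l y + ω i y := by
  rw [lowerFace_eq_toExposed]
  exact and_congr_right fun _ => forall₂_congr fun _ _ => neg_le_neg_iff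

theorem lowerFace_subset : lowerFace A (fun i => ω i) l i ⊆ convexHull ℝ (A i) :=
  convexHull_mono fun _ ha => ha.1

theorem mem_lowerFace_of_sum_eq {q q' : Fin 3 → ℝ × ℝ}
    (hq : ∀ i, q i ∈ lowerFace A (fun i => ω i) l i)
    (hq' : ∀ i, q' i ∈ lowerFace A (fun i => ω i) l' i) (h : ∑ i, q i = ∑ i, q' i) (i : Fin 3) :
    q' i ∈ lowerFace A (fun i => ω i) l i := by
  have hsum (f : (ℝ × ℝ) →L[ℝ] ℝ) : ∑ i, f (q i) = ∑ i, f (q' i) := by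
    rw [← map_sum, ← map_sum, h]
  have hle (i) (_ : i ∈ Finset.univ) : l (q i) + ω i (q i) ≤ l (q' i) + ω i (q' i) :=
    (mem_lowerFace.1 (hq i)).2 _ (lowerFace_subset (hq' i))
  have hle' (i) (_ : i ∈ Finset.univ) : l' (q' i) + ω i (q' i) ≤ l' (q i) + ω i (q i) :=
    (mem_lowerFace.1 (hq' i)).2 _ (lowerFace_subset (hq i))
  have heq : ∑ i, (l (q i) + ω i (q i)) = ∑ i, (l (q' i) + ω i (q' i)) := by
    apply le_antisymm (Finset.sum_le_sum hle)
    have := Finset.sum_le_sum hle'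
    simp only [Finset.sum_add_distrib, hsum] at *
    linarith
  refine mem_lowerFace.2 ⟨lowerFace_subset (hq' i), fun y hy => ?_⟩
  rw [← (Finset.sum_eq_sum_iff_of_le hle).1 heq i (Finset.mem_univ i)]
  exact (mem_lowerFace.1 (hq i)).2 y hy

theorem lowerFace_inter_eq_toExposed
    (h : (lowerFace A (fun i => ω i) l i ∩ lowerFace A (fun i => ω i) l' i).Nonempty) :
    lowerFace A (fun i => ω i) l i ∩ lowerFace A (fun i => ω i) l' i =
      (l - l').toExposed (lowerFace A (fun i => ω i) l i) := by
  obtain ⟨z, hz, hz'⟩ := h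
  ext x
  simp only [ContinuousLinearMap.toExposed, Set.mem_ofPred_eq, Set.mem_inter_iff, sub_apply]
  refine and_congr_right fun hx => ⟨fun hx' y hy => ?_, fun hmax => ?_⟩
  · linarith [(mem_lowerFace.1 hx').2 y (lowerFace_subset hy),
      (mem_lowerFace.1 hy).2 x (lowerFace_subset hx)]
  · refine mem_lowerFace.2 ⟨lowerFace_subset hx, fun y hy => ?_⟩
    linarith [hmax z hz, (mem_lowerFace.1 hz').2 y hy,
      (mem_lowerFace.1 hx).2 z (lowerFace_subset hz)]

theorem lowerFace_inter_eq_toExposed'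
    (h : (lowerFace A (fun i => ω i) l i ∩ lowerFace A (fun i => ω i) l' i).Nonempty) :
    lowerFace A (fun i => ω i) l i ∩ lowerFace A (fun i => ω i) l' i =
      (l' - l).toExposed (lowerFace A (fun i => ω i) l' i) := by
  rw [Set.inter_comm] at h ⊢
  exact lowerFace_inter_eq_toExposed h

theorem intersectProperly_lowerFace (l l' : (ℝ × ℝ) →L[ℝ] ℝ) :
    IntersectProperly (lowerFace A (fun i => ω i) l) (lowerFace A (fun i => ω i) l') := by
  refine ⟨fun i => ⟨fun h => ⟨_, lowerFace_inter_eq_toExposed h⟩,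
    fun h => ⟨_, lowerFace_inter_eq_toExposed' h⟩⟩, ?_⟩
  rintro ⟨p, hp, hp'⟩
  have hne (i) : (lowerFace A (fun i => ω i) l i ∩ lowerFace A (fun i => ω i) l' i).Nonempty := by
    obtain ⟨q, hq, rfl⟩ := MinkowskiTriple.mem_total.1 hp
    obtain ⟨q', hq', h⟩ := MinkowskiTriple.mem_total.1 hp'
    exact ⟨q' i, mem_lowerFace_of_sum_eq hq hq' h.symm i, hq' i⟩
  refine ⟨fun i => lowerFace A (fun i => ω i) l i ∩ lowerFace A (fun i => ω i) l' i,
    ⟨_, fun i => lowerFace_inter_eq_toExposed (hne i)⟩,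
    ⟨_, fun i => lowerFace_inter_eq_toExposed' (hne i)⟩,
    Set.Subset.antisymm ?_ <| Set.subset_inter
      (MinkowskiTriple.total_mono fun i => Set.inter_subset_left)
      (MinkowskiTriple.total_mono fun i => Set.inter_subset_right)⟩
  rintro x ⟨hx, hx'⟩
  obtain ⟨q, hq, rfl⟩ := MinkowskiTriple.mem_total.1 hx
  obtain ⟨q', hq', h⟩ := MinkowskiTriple.mem_total.1 hx'
  exact MinkowskiTriple.mem_total.2
    ⟨q', fun i => ⟨mem_lowerFace_of_sum_eq hq hq' h.symm i, hq' i⟩, h⟩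

theorem finite_setOf_forall_eq_convexHull (hA : ∀ i, (A i).Finite) :
    {R : MinkowskiTriple | ∀ i, ∃ V ⊆ A i, R i = convexHull ℝ V}.Finite := by
  refine (Set.Finite.pi' fun i => (hA i).finite_subsets.image (convexHull ℝ)).subset
    fun R hR i => ?_
  obtain ⟨V, hV, h⟩ := hR i
  exact ⟨V, hV, h.symm⟩

theorem finite_range_lowerFace (hA : ∀ i, (A i).Finite) (ω : Fin 3 → ℝ × ℝ → ℝ) :
    (Set.range (lowerFace A ω)).Finite := by
  refine (finite_setOf_forall_eq_convexHull hA).subset ?_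
  rintro _ ⟨l, rfl⟩ i
  exact ⟨_, fun _ ha => ha.1, rfl⟩

theorem exists_mem_total_lowerFace (hA : ∀ i, (A i).Finite) (ω : Fin 3 → ((ℝ × ℝ) →ₗ[ℝ] ℝ))
    {p : ℝ × ℝ} (hp : p ∈ interior (MinkowskiTriple.total fun i => convexHull ℝ (A i))) :
    ∃ l, p ∈ (lowerFace A (fun i => ω i) l).total := by
  let K : Set (Fin 3 → ℝ × ℝ) := Set.univ.pi fun i => convexHull ℝ (A i)
  let T : (Fin 3 → ℝ × ℝ) →L[ℝ] ℝ × ℝ := ∑ i, .proj i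
  let φ : StrongDual ℝ (Fin 3 → ℝ × ℝ) :=
    ∑ i, (LinearMap.toContinuousLinearMap (ω i)).comp (.proj i)
  have hTK : (MinkowskiTriple.total fun i => convexHull ℝ (A i)) = T '' K := by
    ext x
    simp [MinkowskiTriple.mem_total, T, K]
  rw [hTK] at hp
  obtain ⟨q, hqK, hqp, l, hl⟩ := exists_isMinOn_comp_add
    (isCompact_univ_pi fun i => (hA i).isCompact_convexHull ℝ)
    (convex_pi fun i _ => convex_convexHull ℝ (A i)) T φ hp
  have hmin (r) (hr : r ∈ K) : ∑ i, (l (q i) + ω i (q i)) ≤ ∑ i, (l (r i) + ω i (r i)) := by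
    simpa [T, φ, Finset.sum_add_distrib] using hl hr
  refine ⟨l, MinkowskiTriple.mem_total.2 ⟨q, fun i => ?_, by simpa [T] using hqp⟩⟩
  refine mem_lowerFace.2 ⟨hqK i trivial, fun y hy => ?_⟩
  have hupdate : Function.update q i y ∈ K :=
    (Set.update_mem_pi_iff_of_mem hqK).2 fun _ => hy
  by_contra! hlt
  refine (hmin _ hupdate).not_gt
    (Finset.sum_lt_sum (fun j _ => ?_) ⟨i, Finset.mem_univ i, by simpa using hlt⟩)
  obtain rfl | hj := eq_or_ne j i
  · simpa using hlt.le
  · simp [hj]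

theorem exists_isInducedBy (hA : ∀ i, (A i).Finite) (ω : Fin 3 → ℝ × ℝ → ℝ) :
    ∃ S : Finset MinkowskiTriple, IsInducedBy A ω S := by
  have hfin : {R | ∃ l, R = lowerFace A ω l ∧ affDim R.total = 2}.Finite :=
    (finite_range_lowerFace hA ω).subset fun R ⟨l, h, _⟩ => ⟨l, h.symm⟩
  exact ⟨hfin.toFinset, fun R => hfin.mem_toFinset⟩

theorem volume_eq_zero_of_affDim_ne_two {X : Set (ℝ × ℝ)} (hX : affDim X ≠ 2) :
    volume X = 0 := by
  refine measure_mono_null (subset_affineSpan ℝ X)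
    (Measure.addHaar_affineSubspace _ _ fun h => hX ?_)
  rw [affDim_eq_two_iff_vectorSpan_eq_top, ← direction_affineSpan, h, AffineSubspace.direction_top]

theorem nonempty_of_affDim_eq_two {X : Set (ℝ × ℝ)} (hX : affDim X = 2) : X.Nonempty := by
  by_contra! rfl
  rw [affDim, vectorSpan_empty, finrank_bot] at hX
  omega

theorem interior_nonempty_of_affDim_eq_two {C : Set (ℝ × ℝ)} (hC : Convex ℝ C)
    (h : affDim C = 2) : (interior C).Nonempty := by
  rw [hC.interior_nonempty_iff_affineSpan_eq_top, ← AffineSubspace.direction_eq_top_iff_of_nonempty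
    ((affineSpan_nonempty ℝ).2 (nonempty_of_affDim_eq_two h)), direction_affineSpan]
  exact affDim_eq_two_iff_vectorSpan_eq_top.1 h

variable {S : Finset MinkowskiTriple}

theorem isClosed_total_lowerFace (hA : ∀ i, (A i).Finite) (ω : Fin 3 → ℝ × ℝ → ℝ)
    (l : (ℝ × ℝ) →L[ℝ] ℝ) : IsClosed (lowerFace A ω l).total := by
  have h (i) : IsCompact (lowerFace A ω l i) :=
    ((hA i).subset fun _ ha => ha.1).isCompact_convexHull ℝ
  exact (((h 0).add (h 1)).add (h 2)).isClosed

theorem IsInducedBy.volume_interior_sdiff_eq_zero (hA : ∀ i, (A i).Finite)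
    (hS : IsInducedBy A (fun i => ω i) S) :
    volume (interior (MinkowskiTriple.total fun i => convexHull ℝ (A i)) \ ⋃ R ∈ S, R.total) =
      0 := by
  let N : Set MinkowskiTriple := {R ∈ Set.range (lowerFace A fun i => ω i) | affDim R.total ≠ 2}
  have hN : N.Finite := (finite_range_lowerFace hA _).subset fun R hR => hR.1
  refine measure_mono_null (t := ⋃ R ∈ N, R.total) ?_
    ((measure_biUnion_null_iff hN.countable).2 fun R hR => volume_eq_zero_of_affDim_ne_two hR.2)
  rintro p ⟨hp, hpS⟩
  obtain ⟨l, hl⟩ := exists_mem_total_lowerFace hA ω hp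
  refine Set.mem_iUnion₂_of_mem ⟨⟨l, rfl⟩, fun h => hpS ?_⟩ hl
  exact Set.mem_iUnion₂_of_mem ((hS _).2 ⟨l, rfl, h⟩) hl

/-- The lower faces cover the interior of the whole polygon. Those of lower dimension are null, so
the closed union of the others is dense in it. -/
theorem IsInducedBy.iUnion_total (hA : ∀ i, (A i).Finite)
    (hdim : affDim (MinkowskiTriple.total fun i => convexHull ℝ (A i)) = 2)
    (hS : IsInducedBy A (fun i => ω i) S) :
    (⋃ R ∈ S, R.total) = MinkowskiTriple.total fun i => convexHull ℝ (A i) := by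
  set C := MinkowskiTriple.total fun i => convexHull ℝ (A i)
  have hC : Convex ℝ C := MinkowskiTriple.convex_total fun i => convex_convexHull ℝ _
  apply Set.Subset.antisymm
  · refine Set.iUnion₂_subset fun R hR => ?_
    obtain ⟨l, rfl, -⟩ := (hS R).1 hR
    exact MinkowskiTriple.total_mono fun i => lowerFace_subset
  · have hclosed : IsClosed (⋃ R ∈ S, R.total) := S.finite_toSet.isClosed_biUnion fun R hR => by
      obtain ⟨l, rfl, -⟩ := (hS R).1 hR
      exact isClosed_total_lowerFace hA _ l
    have hempty : interior C \ ⋃ R ∈ S, R.total = ∅ :=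
      ((isOpen_interior.sdiff hclosed).measure_eq_zero_iff volume).1
        (hS.volume_interior_sdiff_eq_zero hA)
    calc C ⊆ closure C := subset_closure
      _ = closure (interior C) := (hC.closure_interior_eq_closure_of_nonempty_interior
        (interior_nonempty_of_affDim_eq_two hC hdim)).symm
      _ ⊆ ⋃ R ∈ S, R.total := closure_minimal (Set.sdiff_eq_empty.1 hempty) hclosed

theorem IsInducedBy.isMixedSubdivision (hA : ∀ i, (A i).Finite)
    (hdim : affDim (MinkowskiTriple.total fun i => convexHull ℝ (A i)) = 2)
    (hS : IsInducedBy A (fun i => ω i) S) : IsMixedSubdivision A S := by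
  refine ⟨fun R hR => ?_, hS.iUnion_total hA hdim, fun R hR R' hR' => ?_⟩
  · obtain ⟨l, rfl, h⟩ := (hS R).1 hR
    refine ⟨fun i => ⟨_, fun a ha => ha.1, ?_, rfl⟩, h⟩
    obtain ⟨p, hp⟩ := nonempty_of_affDim_eq_two h
    obtain ⟨q, hq, -⟩ := MinkowskiTriple.mem_total.1 hp
    exact convexHull_nonempty_iff.1 ⟨q i, hq i⟩
  · obtain ⟨l, rfl, -⟩ := (hS R).1 hR
    obtain ⟨l', rfl, -⟩ := (hS R').1 hR'
    exact intersectProperly_lowerFace l l'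

end LinearLifting

/-! ### Lower faces of linear liftings of the supports -/

/-- The points of `A` at which `f` is minimal. -/
def minimizers {X : Type*} (f : X → ℝ) (A : Set X) : Set X := {a ∈ A | ∀ a' ∈ A, f a ≤ f a'}

/-- The smallest minimizer of `z ↦ s * z` on a set with least element `m` and greatest element
`M`. -/
noncomputable def firstMin (m M s : ℝ) : ℝ := if s < 0 then M else m

/-- The largest minimizer of `z ↦ s * z` on a set with least element `m` and greatest element
`M`. -/
noncomputable def lastMin (m M s : ℝ) : ℝ := if 0 < s then m else M

section Minimizers

variable {T : Set ℝ} {m M s h n b c : ℝ}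

theorem isLeast_image_mul_left (hm : IsLeast T m) (hM : IsGreatest T M) (s : ℝ) :
    IsLeast ((s * ·) '' T) (min (s * m) (s * M)) := by
  constructor
  · rcases min_choice (s * m) (s * M) with h | h <;> rw [h]
    exacts [⟨m, hm.1, rfl⟩, ⟨M, hM.1, rfl⟩]
  · rintro _ ⟨z, hz, rfl⟩
    rcases le_total 0 s with hs | hs
    · exact (min_le_left _ _).trans (mul_le_mul_of_nonneg_left (hm.2 hz) hs)
    · exact (min_le_right _ _).trans (mul_le_mul_of_nonpos_left (hM.2 hz) hs)

theorem minimizers_mul_left_of_pos (hm : IsLeast T m) (hs : 0 < s) :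
    minimizers (s * ·) T = {m} := by
  refine Set.eq_singleton_iff_unique_mem.2 ⟨⟨hm.1, fun z hz => ?_⟩, fun z hz => ?_⟩
  · exact mul_le_mul_of_nonneg_left (hm.2 hz) hs.le
  · exact (le_of_mul_le_mul_left (hz.2 m hm.1) hs).antisymm (hm.2 hz.1)

theorem minimizers_mul_left_of_neg (hM : IsGreatest T M) (hs : s < 0) :
    minimizers (s * ·) T = {M} := by
  refine Set.eq_singleton_iff_unique_mem.2 ⟨⟨hM.1, fun z hz => ?_⟩, fun z hz => ?_⟩
  · exact mul_le_mul_of_nonpos_left (hM.2 hz) hs.le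
  · exact (hM.2 hz.1).antisymm ((mul_le_mul_left_of_neg hs).1 (hz.2 M hM.1))

theorem minimizers_zero_mul (T : Set ℝ) : minimizers (0 * ·) T = T := by
  simp [minimizers]

theorem isLeast_minimizers_mul_left (hm : IsLeast T m) (hM : IsGreatest T M) (s : ℝ) :
    IsLeast (minimizers (s * ·) T) (firstMin m M s) := by
  rcases lt_trichotomy s 0 with hs | rfl | hs
  · rw [minimizers_mul_left_of_neg hM hs, firstMin, if_pos hs]
    exact isLeast_singleton
  · rwa [minimizers_zero_mul, firstMin, if_neg (lt_irrefl 0)]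
  · rw [minimizers_mul_left_of_pos hm hs, firstMin, if_neg hs.not_gt]
    exact isLeast_singleton

theorem isGreatest_minimizers_mul_left (hm : IsLeast T m) (hM : IsGreatest T M) (s : ℝ) :
    IsGreatest (minimizers (s * ·) T) (lastMin m M s) := by
  rcases lt_trichotomy s 0 with hs | rfl | hs
  · rw [minimizers_mul_left_of_neg hM hs, lastMin, if_neg hs.not_gt]
    exact isGreatest_singleton
  · rwa [minimizers_zero_mul, lastMin, if_neg (lt_irrefl 0)]
  · rw [minimizers_mul_left_of_pos hm hs, lastMin, if_pos hs]
    exact isGreatest_singleton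

theorem firstMin_eq_lastMin (hs : s ≠ 0) : firstMin m M s = lastMin m M s := by
  unfold firstMin lastMin
  grind

theorem forall_mem_apexSupport {P : ℝ × ℝ → Prop} :
    (∀ p ∈ apexSupport T, P p) ↔ P (0, 1) ∧ ∀ z ∈ T, P (z, 0) := by
  rw [apexSupport, Set.forall_mem_insert, Set.forall_mem_image]

theorem base_mem_apexSupport_iff {z : ℝ} : (z, 0) ∈ apexSupport T ↔ z ∈ T := by
  simp [apexSupport]

theorem apex_mem_minimizers_iff (hn : IsLeast ((s * ·) '' T) n) :
    (0, 1) ∈ minimizers (fun p => s * p.1 + h * p.2) (apexSupport T) ↔ h ≤ n := by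
  rw [le_isGLB_iff hn.isGLB, mem_lowerBounds, Set.forall_mem_image, minimizers, Set.mem_ofPred_eq,
    forall_mem_apexSupport]
  simp [apexSupport]

theorem base_mem_minimizers_iff {z : ℝ} (hn : IsLeast ((s * ·) '' T) n) :
    (z, 0) ∈ minimizers (fun p => s * p.1 + h * p.2) (apexSupport T) ↔
      z ∈ minimizers (s * ·) T ∧ n ≤ h := by
  simp only [minimizers, Set.mem_ofPred_eq, forall_mem_apexSupport, base_mem_apexSupport_iff,
    mul_zero, zero_add, add_zero, mul_one, and_assoc]
  refine and_congr_right fun hz => and_comm.trans (and_congr_right fun hmin => ?_)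
  rw [hn.unique ⟨⟨z, hz, rfl⟩, Set.forall_mem_image.2 fun z' => hmin z'⟩]

theorem convexHull_minimizers_of_lt (hn : IsLeast ((s * ·) '' T) n) (hlt : h < n) :
    convexHull ℝ (minimizers (fun p => s * p.1 + h * p.2) (apexSupport T)) = {(0, 1)} := by
  rw [(Set.eq_singleton_iff_unique_mem.2 ⟨(apex_mem_minimizers_iff hn).2 hlt.le, fun p hp => ?_⟩ :
    minimizers (fun p => s * p.1 + h * p.2) (apexSupport T) = {(0, 1)}), convexHull_singleton]
  rcases hp.1 with rfl | ⟨z, -, rfl⟩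
  exacts [rfl, absurd ((base_mem_minimizers_iff hn).1 hp).2 hlt.not_ge]

theorem convexHull_minimizers_of_gt (hn : IsLeast ((s * ·) '' T) n) (hlt : n < h)
    (hb : IsLeast (minimizers (s * ·) T) b)
    (hc : IsGreatest (minimizers (s * ·) T) c) :
    convexHull ℝ (minimizers (fun p => s * p.1 + h * p.2) (apexSupport T)) = baseEdge b c := by
  refine convexHull_eq_baseEdge (fun p hp => ?_) ((base_mem_minimizers_iff hn).2 ⟨hb.1, hlt.le⟩)
    ((base_mem_minimizers_iff hn).2 ⟨hc.1, hlt.le⟩)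
  rcases hp.1 with rfl | ⟨z, -, rfl⟩
  · exact absurd ((apex_mem_minimizers_iff hn).1 hp) hlt.not_ge
  · have hz := ((base_mem_minimizers_iff hn).1 hp).1
    exact ⟨hb.2 hz, hc.2 hz, rfl⟩

theorem convexHull_minimizers_of_eq (hn : IsLeast ((s * ·) '' T) n) (heq : h = n)
    (hb : IsLeast (minimizers (s * ·) T) b)
    (hc : IsGreatest (minimizers (s * ·) T) c) :
    convexHull ℝ (minimizers (fun p => s * p.1 + h * p.2) (apexSupport T)) = apexCone b c := by
  refine convexHull_eq_apexCone (fun p hp => ?_) ((apex_mem_minimizers_iff hn).2 heq.le)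
    ((base_mem_minimizers_iff hn).2 ⟨hb.1, heq.ge⟩) ((base_mem_minimizers_iff hn).2 ⟨hc.1, heq.ge⟩)
  rcases hp.1 with rfl | ⟨z, -, rfl⟩
  · exact apex_mem_apexCone b c
  · have hz := ((base_mem_minimizers_iff hn).1 hp).1
    exact base_mem_apexCone (hb.2 hz) (hc.2 hz)

end Minimizers

/-- The linear functions `(x, y) ↦ α i * x - w i * y`. -/
noncomputable def linearLift (α w : Fin 3 → ℝ) (i : Fin 3) : (ℝ × ℝ) →ₗ[ℝ] ℝ :=
  α i • LinearMap.fst ℝ ℝ ℝ - w i • LinearMap.snd ℝ ℝ ℝ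

/-- The function whose graph separates the functionals that are minimal at the apex of the `i`-th
lifted support from those that are minimal at its base. -/
noncomputable def dualGraph (m M α w : Fin 3 → ℝ) (i : Fin 3) (x : ℝ) : ℝ :=
  w i + min ((x + α i) * m i) ((x + α i) * M i)

section LinearLift

variable {B : Fin 3 → Finset ℕ} {m M α w : Fin 3 → ℝ} {l : (ℝ × ℝ) →L[ℝ] ℝ} {i : Fin 3}

theorem lowerFace_linearLift (B : Fin 3 → Finset ℕ) (α w : Fin 3 → ℝ) (l : (ℝ × ℝ) →L[ℝ] ℝ)
    (i : Fin 3) : lowerFace (curveSupports B) (fun i => linearLift α w i) l i =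
      convexHull ℝ (minimizers (fun p => (l (1, 0) + α i) * p.1 + (l (0, 1) - w i) * p.2)
        (apexSupport (realSupport B i))) := by
  have hval (p : ℝ × ℝ) :
      l p + linearLift α w i p = (l (1, 0) + α i) * p.1 + (l (0, 1) - w i) * p.2 := by
    rw [linear_apply_prod l p, linearLift]
    simp
    ring
  simp only [lowerFace, minimizers, hval, curveSupports_eq_apexSupport]

theorem isLeast_image_add_mul (hm : ∀ i, IsLeast (realSupport B i) (m i))
    (hM : ∀ i, IsGreatest (realSupport B i) (M i)) (x : ℝ) :
    IsLeast (((x + α i) * ·) '' realSupport B i) (dualGraph m M α w i x - w i) := by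
  rw [dualGraph, add_sub_cancel_left]
  exact isLeast_image_mul_left (hm i) (hM i) _

theorem lowerFace_linearLift_of_lt (hm : ∀ i, IsLeast (realSupport B i) (m i))
    (hM : ∀ i, IsGreatest (realSupport B i) (M i))
    (h : l (0, 1) < dualGraph m M α w i (l (1, 0))) :
    lowerFace (curveSupports B) (fun i => linearLift α w i) l i = {(0, 1)} := by
  rw [lowerFace_linearLift]
  exact convexHull_minimizers_of_lt (isLeast_image_add_mul hm hM _) (sub_lt_sub_right h _)

theorem lowerFace_linearLift_of_gt (hm : ∀ i, IsLeast (realSupport B i) (m i))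
    (hM : ∀ i, IsGreatest (realSupport B i) (M i))
    (h : dualGraph m M α w i (l (1, 0)) < l (0, 1)) :
    lowerFace (curveSupports B) (fun i => linearLift α w i) l i =
      baseEdge (firstMin (m i) (M i) (l (1, 0) + α i)) (lastMin (m i) (M i) (l (1, 0) + α i)) := by
  rw [lowerFace_linearLift]
  exact convexHull_minimizers_of_gt (isLeast_image_add_mul hm hM _) (sub_lt_sub_right h _)
    (isLeast_minimizers_mul_left (hm i) (hM i) _) (isGreatest_minimizers_mul_left (hm i) (hM i) _)

theorem lowerFace_linearLift_of_eq (hm : ∀ i, IsLeast (realSupport B i) (m i))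
    (hM : ∀ i, IsGreatest (realSupport B i) (M i))
    (h : l (0, 1) = dualGraph m M α w i (l (1, 0))) :
    lowerFace (curveSupports B) (fun i => linearLift α w i) l i =
      apexCone (firstMin (m i) (M i) (l (1, 0) + α i)) (lastMin (m i) (M i) (l (1, 0) + α i)) := by
  rw [lowerFace_linearLift]
  exact convexHull_minimizers_of_eq (isLeast_image_add_mul hm hM _) (congrArg (· - w i) h)
    (isLeast_minimizers_mul_left (hm i) (hM i) _) (isGreatest_minimizers_mul_left (hm i) (hM i) _)

theorem lowerFace_linearLift_eq_apex_iff (hm : ∀ i, IsLeast (realSupport B i) (m i))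
    (hM : ∀ i, IsGreatest (realSupport B i) (M i)) :
    lowerFace (curveSupports B) (fun i => linearLift α w i) l i = {(0, 1)} ↔
      l (0, 1) < dualGraph m M α w i (l (1, 0)) := by
  refine ⟨fun h => ?_, lowerFace_linearLift_of_lt hm hM⟩
  by_contra! hle
  have hbase := subset_convexHull ℝ _ ((base_mem_minimizers_iff (isLeast_image_add_mul hm hM _)).2
    ⟨(isLeast_minimizers_mul_left (hm i) (hM i) (l (1, 0) + α i)).1, sub_le_sub_right hle (w i)⟩)
  rw [← lowerFace_linearLift, h] at hbase
  simp at hbase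

theorem affDim_lowerFace_linearLift_le (hm : ∀ i, IsLeast (realSupport B i) (m i))
    (hM : ∀ i, IsGreatest (realSupport B i) (M i)) :
    affDim (lowerFace (curveSupports B) (fun i => linearLift α w i) l i) ≤
      (if l (0, 1) = dualGraph m M α w i (l (1, 0)) then 1 else 0) +
        if l (1, 0) + α i = 0 then 1 else 0 := by
  set b := firstMin (m i) (M i) (l (1, 0) + α i) with hb
  set c := lastMin (m i) (M i) (l (1, 0) + α i) with hc
  have hbc : b = c ∨ b < c ∧ l (1, 0) + α i = 0 := by
    rcases eq_or_ne (l (1, 0) + α i) 0 with hx | hx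
    · refine ((isLeast_minimizers_mul_left (hm i) (hM i) _).2
        (isGreatest_minimizers_mul_left (hm i) (hM i) _).1).eq_or_lt.imp_right (⟨·, hx⟩)
    · exact .inl (firstMin_eq_lastMin hx)
  rcases lt_trichotomy (l (0, 1)) (dualGraph m M α w i (l (1, 0))) with h | h | h
  · rw [lowerFace_linearLift_of_lt hm hM h, affDim_singleton]
    exact Nat.zero_le _
  · rw [lowerFace_linearLift_of_eq hm hM h, ← hb, ← hc, if_pos h]
    rcases hbc with hbc | ⟨hbc, hx⟩
    · rw [hbc, affDim_apexCone_self]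
      exact Nat.le_add_right _ _
    · rw [affDim_apexCone hbc, if_pos hx]
  · rw [lowerFace_linearLift_of_gt hm hM h, ← hb, ← hc]
    rcases hbc with hbc | ⟨hbc, hx⟩
    · rw [hbc, baseEdge_self, affDim_singleton]
      exact Nat.zero_le _
    · rw [affDim_baseEdge hbc, if_pos hx]
      exact Nat.le_add_left _ _

theorem affDim_add_le (X Y : Set (ℝ × ℝ)) : affDim (X + Y) ≤ affDim X + affDim Y := by
  have hle : vectorSpan ℝ (X + Y) ≤ vectorSpan ℝ X ⊔ vectorSpan ℝ Y := by
    rw [vectorSpan_def, Submodule.span_le]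
    rintro _ ⟨_, ⟨x, hx, y, hy, rfl⟩, _, ⟨x', hx', y', hy', rfl⟩, rfl⟩
    simp only [vsub_eq_sub, add_sub_add_comm]
    exact Submodule.add_mem_sup (vsub_mem_vectorSpan ℝ hx hx') (vsub_mem_vectorSpan ℝ hy hy')
  exact (Submodule.finrank_mono hle).trans (Submodule.finrank_add_le_finrank_add_finrank _ _)

theorem MinkowskiTriple.affDim_total_le (R : MinkowskiTriple) :
    affDim R.total ≤ ∑ i, affDim (R i) := by
  rw [Fin.sum_univ_three]
  exact (affDim_add_le _ _).trans (Nat.add_le_add_right (affDim_add_le _ _) _)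

theorem sum_affDim_lowerFace_linearLift (hm : ∀ i, IsLeast (realSupport B i) (m i))
    (hM : ∀ i, IsGreatest (realSupport B i) (M i)) (hα : Function.Injective α)
    (hkink : ∀ i, Function.Injective fun j => dualGraph m M α w j (-α i))
    (hmeet : ∀ x y, ∃ i, dualGraph m M α w i x ≠ y)
    (hl : affDim (lowerFace (curveSupports B) (fun i => linearLift α w i) l).total = 2) :
    ∑ i, affDim (lowerFace (curveSupports B) (fun i => linearLift α w i) l i) = 2 := by
  refine le_antisymm ?_ (hl ▸ MinkowskiTriple.affDim_total_le _)
  refine (Finset.sum_le_sum fun i _ => affDim_lowerFace_linearLift_le hm hM).trans ?_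
  rw [Finset.sum_add_distrib, ← Finset.card_filter, ← Finset.card_filter]
  by_cases hx : ∃ i, l (1, 0) + α i = 0
  · obtain ⟨i, hi⟩ := hx
    rw [add_eq_zero_iff_eq_neg] at hi
    refine Nat.add_le_add (Finset.card_le_one.2 fun j hj k hk => ?_)
      (Finset.card_le_one.2 fun j hj k hk => ?_)
    · rw [Finset.mem_filter, hi] at hj hk
      exact hkink i (hj.2.symm.trans hk.2)
    · rw [Finset.mem_filter] at hj hk
      exact hα (add_left_cancel (hj.2.trans hk.2.symm))
  · push Not at hx
    obtain ⟨i, hi⟩ := hmeet (l (1, 0)) (l (0, 1))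
    rw [Finset.filter_false_of_mem fun i _ => hx i, Finset.card_empty, add_zero,
      ← Nat.lt_succ_iff, ← Fintype.card_fin (Nat.succ 2), ← Finset.card_univ]
    exact Finset.card_lt_card
      (Finset.filter_ssubset.2 ⟨i, Finset.mem_univ i, fun h => hi h.symm⟩)

end LinearLift

/-! ### Generic linear liftings -/

/-- If `s p < s q` and `s p < s r`, the line `y = a p + s p * x` meets the line `y = a q + s q * x`
to the right or to the left of the line `y = a r + s r * x` according to whether this determinant is
positive or negative. -/
def lineDet (a s : Fin 3 → ℝ) (p q r : Fin 3) : ℝ :=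
  (a p - a q) * (s r - s p) - (a p - a r) * (s q - s p)

/-- No two of the lines `y = w i + s i * x` meet on the third one. -/
def IsGenericWeight (s w : Fin 3 → ℝ) : Prop :=
  ∀ p q r, IsLabelling p q r → s p ≠ s q → lineDet w s p q r ≠ 0

section LineDet

variable {a s : Fin 3 → ℝ} {p q r : Fin 3} {x z : ℝ}

theorem lineDet_swap (a s : Fin 3 → ℝ) (p q r : Fin 3) :
    lineDet a s p r q = -lineDet a s p q r := by
  unfold lineDet
  ring

theorem lineDet_neg_right (a s : Fin 3 → ℝ) (p q r : Fin 3) :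
    lineDet a (-s) p q r = -lineDet a s p q r := by
  simp only [lineDet, Pi.neg_apply]
  ring

theorem lineDet_add_mul (a s : Fin 3 → ℝ) (x : ℝ) (p q r : Fin 3) :
    lineDet (fun i => a i + s i * x) s p q r = lineDet a s p q r := by
  unfold lineDet
  ring

theorem lineDet_neg (hr : a p + s p * x = a r + s r * x) (hq : a p + s p * x < a q + s q * x)
    (hs : s p < s r) : lineDet a s p q r < 0 := by
  rw [← lineDet_add_mul a s x, lineDet, sub_eq_zero.2 hr, zero_mul, sub_zero]
  exact mul_neg_of_neg_of_pos (sub_neg.2 hq) (sub_pos.2 hs)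

theorem lineDet_eq_zero (hq : a p + s p * x = a q + s q * x)
    (hr : a p + s p * x = a r + s r * x) : lineDet a s p q r = 0 := by
  rw [← lineDet_add_mul a s x, lineDet, sub_eq_zero.2 hq, sub_eq_zero.2 hr, zero_mul, zero_mul,
    sub_zero]

theorem slope_lt_slope (hzx : z < x) (hz : a q + s q * z < a p + s p * z)
    (hx : a p + s p * x ≤ a q + s q * x) : s p < s q := by
  have : s p * (x - z) < s q * (x - z) := by linarith
  exact lt_of_mul_lt_mul_right this (sub_pos.2 hzx).le

end LineDet

theorem dualGraph_of_nonneg {m M α w : Fin 3 → ℝ} {i : Fin 3} {x : ℝ} (hmM : m i ≤ M i)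
    (hx : 0 ≤ x + α i) : dualGraph m M α w i x = (w + α * m) i + m i * x := by
  rw [dualGraph, min_eq_left (mul_le_mul_of_nonneg_left hmM hx), Pi.add_apply, Pi.mul_apply]
  ring

theorem dualGraph_reflect (m M α w : Fin 3 → ℝ) (i : Fin 3) (x : ℝ) :
    dualGraph (-M) (-m) (-α) w i (-x) = dualGraph m M α w i x := by
  simp only [dualGraph, Pi.neg_apply, ← neg_add, neg_mul_neg, min_comm]

/-- Conditions on a linear lifting under which it induces a tight subdivision with known exponents:
the kinks of the dual graphs are distinct and at distance at most `ε` from `0`, the graphs are there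
in the order of their weights, and the perturbation `α` does not change the order in which the
outer rays of the three graphs meet. -/
structure IsGenericLift (m M α w : Fin 3 → ℝ) (ε : ℝ) : Prop where
  injective : Function.Injective α
  abs_kink_le : ∀ i, |α i| ≤ ε
  dualGraph_lt : ∀ x, |x| ≤ ε → ∀ i j, w i < w j → dualGraph m M α w i x < dualGraph m M α w j x
  lineDet_right : ∀ p q r, IsLabelling p q r → m p ≠ m q →
    0 < lineDet (w + α * m) m p q r * lineDet w m p q r
  lineDet_left : ∀ p q r, IsLabelling p q r → M p ≠ M q →
    0 < lineDet (w + α * M) M p q r * lineDet w M p q r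

/-- The graphs of `g p` and `g o` meet to the right of `ε` at a point below the graph of `g t`. -/
def MeetsBelow (g : Fin 3 → ℝ → ℝ) (ε : ℝ) (p o t : Fin 3) : Prop :=
  ∃ x, ε < x ∧ g p x = g o x ∧ g p x < g t x

/-- The cell with the apex as its `t`-th summand and edges from the apex to `(s i, 0)` as the other
summands. -/
def slantCell (t : Fin 3) (s : Fin 3 → ℝ) : MinkowskiTriple :=
  fun i => if i = t then {((0 : ℝ), (1 : ℝ))} else apexCone (s i) (s i)

open Classical in
/-- The area of the cell `slantCell t s` if it occurs in the subdivision dual to the graphs `g`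
to the right of `ε`, and `0` otherwise. -/
noncomputable def slantArea (s : Fin 3 → ℝ) (g : Fin 3 → ℝ → ℝ) (ε : ℝ) (p o t : Fin 3) : ℝ :=
  if MeetsBelow g ε p o t then |s o - s p| else 0

theorem volume_real_slantCell {p o t : Fin 3} (hl : IsLabelling p o t) (s : Fin 3 → ℝ) :
    volume.real (slantCell t s).total = |s o - s p| := by
  rw [MinkowskiTriple.volume_real_total_eq _ hl (if_pos rfl), slantCell, slantCell,
    if_neg hl.ne₁₃, if_neg hl.ne₂₃, apexCone_self, apexCone_self, volume_real_segment_add_segment]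
  congr 1
  ring

namespace IsGenericLift

variable {m M α w : Fin 3 → ℝ} {ε x : ℝ} {p q r o t i j : Fin 3}

theorem nonneg (h : IsGenericLift m M α w ε) : 0 ≤ ε := (abs_nonneg _).trans (h.abs_kink_le 0)

theorem reflect (h : IsGenericLift m M α w ε) : IsGenericLift (-M) (-m) (-α) w ε where
  injective := neg_injective.comp h.injective
  abs_kink_le i := (abs_neg (α i)).trans_le (h.abs_kink_le i)
  dualGraph_lt x hx i j hij := by
    rw [← neg_neg x, dualGraph_reflect, dualGraph_reflect]
    exact h.dualGraph_lt (-x) ((abs_neg x).trans_le hx) i j hij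
  lineDet_right p q r hl hpq := by
    rw [neg_mul_neg, lineDet_neg_right, lineDet_neg_right, neg_mul_neg]
    exact h.lineDet_left p q r hl fun h' => hpq (congrArg Neg.neg h')
  lineDet_left p q r hl hpq := by
    rw [neg_mul_neg, lineDet_neg_right, lineDet_neg_right, neg_mul_neg]
    exact h.lineDet_right p q r hl fun h' => hpq (congrArg Neg.neg h')

theorem dualGraph_eq (h : IsGenericLift m M α w ε) (hmM : m ≤ M) (hx : ε ≤ x) (i : Fin 3) :
    dualGraph m M α w i x = (w + α * m) i + m i * x :=
  dualGraph_of_nonneg (hmM i) (by linarith [neg_le_of_abs_le (h.abs_kink_le i)])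

theorem injective_dualGraph (h : IsGenericLift m M α w ε) (hw : Function.Injective w)
    (hx : |x| ≤ ε) : Function.Injective fun i => dualGraph m M α w i x := by
  refine fun i j hij => hw ?_
  by_contra hne
  rcases lt_or_gt_of_ne hne with hlt | hlt
  exacts [(h.dualGraph_lt x hx _ _ hlt).ne hij, (h.dualGraph_lt x hx _ _ hlt).ne' hij]

theorem slope_lt_of_dualGraph_le (h : IsGenericLift m M α w ε) (hmM : m ≤ M) (hw : w i < w p)
    (hx : ε < x) (hle : dualGraph m M α w p x ≤ dualGraph m M α w i x) : m p < m i := by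
  have hlt := h.dualGraph_lt ε (abs_of_nonneg h.nonneg).le i p hw
  rw [h.dualGraph_eq hmM le_rfl, h.dualGraph_eq hmM le_rfl] at hlt
  rw [h.dualGraph_eq hmM hx.le, h.dualGraph_eq hmM hx.le] at hle
  exact slope_lt_slope hx hlt hle

theorem exists_dualGraph_ne_of_lt (h : IsGenericLift m M α w ε) (hmM : m ≤ M)
    (hw : Function.Injective w) (hx : ε < x) (y : ℝ) : ∃ i, dualGraph m M α w i x ≠ y := by
  by_contra! heq
  have hslope : m 0 ≠ m 1 := by
    rcases lt_or_gt_of_ne (hw.ne (zero_ne_one (α := Fin 3))) with hlt | hlt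
    · exact (h.slope_lt_of_dualGraph_le hmM hlt hx (by rw [heq, heq])).ne'
    · exact (h.slope_lt_of_dualGraph_le hmM hlt hx (by rw [heq, heq])).ne
  have hpos := h.lineDet_right 0 1 2 ⟨by decide, by decide, by decide⟩ hslope
  simp only [h.dualGraph_eq hmM hx.le] at heq
  rw [lineDet_eq_zero ((heq 0).trans (heq 1).symm) ((heq 0).trans (heq 2).symm), zero_mul] at hpos
  exact lt_irrefl _ hpos

theorem exists_dualGraph_ne (h : IsGenericLift m M α w ε) (hmM : m ≤ M)
    (hw : Function.Injective w) (x y : ℝ) : ∃ i, dualGraph m M α w i x ≠ y := by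
  rcases le_or_gt |x| ε with hx | hx
  · by_contra! heq
    exact absurd (h.injective_dualGraph hw hx ((heq 0).trans (heq 1).symm)) (by decide)
  rcases lt_abs.1 hx with hx | hx
  · exact h.exists_dualGraph_ne_of_lt hmM hw hx y
  · obtain ⟨i, hi⟩ := h.reflect.exists_dualGraph_ne_of_lt (neg_le_neg hmM) hw hx y
    exact ⟨i, by rwa [dualGraph_reflect] at hi⟩

theorem lineDet_neg_of_meetsBelow (h : IsGenericLift m M α w ε) (hl : IsLabelling p q r)
    (hmM : m ≤ M) (hq : w q < w p) (hr : w r < w p)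
    (hmeet : MeetsBelow (dualGraph m M α w) ε p r q) :
    m p < m q ∧ m p < m r ∧ lineDet w m p q r < 0 := by
  obtain ⟨x, hx, heq, hlt⟩ := hmeet
  have hmq := h.slope_lt_of_dualGraph_le hmM hq hx hlt.le
  have hmr := h.slope_lt_of_dualGraph_le hmM hr hx heq.le
  simp only [h.dualGraph_eq hmM hx.le] at heq hlt
  exact ⟨hmq, hmr, neg_of_mul_pos_right (h.lineDet_right p q r hl hmq.ne)
    (lineDet_neg heq hlt hmr).le⟩

theorem slantArea_add_slantArea_le_endCost (h : IsGenericLift m M α w ε)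
    (hl : IsLabelling p q r) (hmM : m ≤ M) (hq : w q < w p) (hr : w r < w p) :
    (w p - w q) * slantArea m (dualGraph m M α w) ε p r q +
      (w p - w r) * slantArea m (dualGraph m M α w) ε p q r ≤
      endCost m (fun i => w p - w i) p q r := by
  have hneg := h.lineDet_neg_of_meetsBelow hl hmM hq hr
  have hpos := h.lineDet_neg_of_meetsBelow hl.swap₂₃ hmM hr hq
  unfold slantArea endCost
  by_cases hE : MeetsBelow (dualGraph m M α w) ε p r q
  · obtain ⟨hmq, hmr, hdet⟩ := hneg hE
    have hF : ¬ MeetsBelow (dualGraph m M α w) ε p q r := fun hF => by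
      linarith [(hpos hF).2.2, lineDet_swap w m p q r]
    rw [if_pos hE, if_neg hF, abs_of_pos (sub_pos.2 hmr), max_eq_left (sub_pos.2 hmr).le,
      max_eq_left (sub_pos.2 hmq).le, mul_zero, add_zero]
    exact le_min le_rfl (sub_neg.1 hdet).le
  by_cases hF : MeetsBelow (dualGraph m M α w) ε p q r
  · obtain ⟨hmr, hmq, hdet⟩ := hpos hF
    rw [if_neg hE, if_pos hF, abs_of_pos (sub_pos.2 hmq), max_eq_left (sub_pos.2 hmr).le,
      max_eq_left (sub_pos.2 hmq).le, mul_zero, zero_add]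
    exact le_min (sub_neg.1 hdet).le le_rfl
  · rw [if_neg hE, if_neg hF, mul_zero, mul_zero, add_zero]
    exact le_min (mul_nonneg (sub_pos.2 hq).le (le_max_right _ _))
      (mul_nonneg (sub_pos.2 hr).le (le_max_right _ _))

end IsGenericLift

section ApexMixed

variable {B : Fin 3 → Finset ℕ} {m M α w : Fin 3 → ℝ} {l : (ℝ × ℝ) →L[ℝ] ℝ} {i t : Fin 3}

theorem le_of_isApexMixed_lowerFace (hm : ∀ i, IsLeast (realSupport B i) (m i))
    (hM : ∀ i, IsGreatest (realSupport B i) (M i)) (hi : i ≠ t)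
    (hl : IsApexMixed t (lowerFace (curveSupports B) (fun i => linearLift α w i) l)) :
    dualGraph m M α w i (l (1, 0)) ≤ l (0, 1) := by
  by_contra! hlt
  simpa [lowerFace_linearLift_of_lt hm hM hlt, affDim_singleton] using hl.2 i hi

theorem eq_of_isApexMixed_lowerFace (hm : ∀ i, IsLeast (realSupport B i) (m i))
    (hM : ∀ i, IsGreatest (realSupport B i) (M i)) (hx : l (1, 0) + α i ≠ 0) (hi : i ≠ t)
    (hl : IsApexMixed t (lowerFace (curveSupports B) (fun i => linearLift α w i) l)) :
    l (0, 1) = dualGraph m M α w i (l (1, 0)) := by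
  by_contra hne
  simpa [hl.2 i hi, hne, hx] using
    affDim_lowerFace_linearLift_le (α := α) (w := w) (l := l) (i := i) hm hM

theorem lowerFace_linearLift_eq_slantCell (hm : ∀ i, IsLeast (realSupport B i) (m i))
    (hM : ∀ i, IsGreatest (realSupport B i) (M i)) (hx : ∀ i, l (1, 0) + α i ≠ 0)
    (hl : IsApexMixed t (lowerFace (curveSupports B) (fun i => linearLift α w i) l)) :
    lowerFace (curveSupports B) (fun i => linearLift α w i) l =
      slantCell t fun i => firstMin (m i) (M i) (l (1, 0) + α i) := by
  funext i
  by_cases hi : i = t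
  · rw [slantCell, if_pos hi, hi, hl.1]
  · rw [slantCell, if_neg hi,
      lowerFace_linearLift_of_eq hm hM (eq_of_isApexMixed_lowerFace hm hM (hx i) hi hl),
      ← firstMin_eq_lastMin (hx i)]

end ApexMixed

theorem sum_le_ite_add_ite {ι : Type*} {F : Finset ι} {f : ι → ℝ} (hf : 0 ≤ f) {P Q : Prop}
    [Decidable P] [Decidable Q] {a b : ι} (hF : ∀ R ∈ F, P ∧ R = a ∨ Q ∧ R = b) :
    ∑ R ∈ F, f R ≤ (if P then f a else 0) + if Q then f b else 0 := by
  classical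
  have hsub : F ⊆ (if P then {a} else ∅) ∪ if Q then {b} else ∅ := by
    intro R hR
    rcases hF R hR with ⟨hP, rfl⟩ | ⟨hQ, rfl⟩ <;> simp [*]
  calc ∑ R ∈ F, f R ≤ ∑ R ∈ (if P then {a} else ∅) ∪ (if Q then {b} else ∅), f R :=
        Finset.sum_le_sum_of_subset_of_nonneg hsub fun R _ _ => hf R
    _ ≤ ∑ R ∈ (if P then {a} else ∅), f R + ∑ R ∈ (if Q then {b} else ∅), f R := by
        rw [← Finset.sum_union_inter]
        exact le_add_of_nonneg_right (Finset.sum_nonneg fun R _ => hf R)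
    _ = _ := by split_ifs <;> simp

namespace IsGenericLift

variable {B : Fin 3 → Finset ℕ} {m M α w : Fin 3 → ℝ} {ε : ℝ} {p q r o t : Fin 3}
  {l : (ℝ × ℝ) →L[ℝ] ℝ} {S : Finset MinkowskiTriple}

theorem isTightMixedSubdivision (h : IsGenericLift m M α w ε) (hw : Function.Injective w)
    (hm : ∀ i, IsLeast (realSupport B i) (m i)) (hM : ∀ i, IsGreatest (realSupport B i) (M i))
    (hS : IsInducedBy (curveSupports B) (fun i => linearLift α w i) S)
    (hmixed : IsMixedSubdivision (curveSupports B) S) :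
    IsTightMixedSubdivision (curveSupports B) S := by
  refine ⟨hmixed, fun R hR => ?_⟩
  obtain ⟨l, rfl, hdim⟩ := (hS R).1 hR
  refine sum_affDim_lowerFace_linearLift hm hM h.injective (fun i => ?_)
    (h.exists_dualGraph_ne (fun i => (hm i).2 (hM i).1) hw) hdim
  exact h.injective_dualGraph hw ((abs_neg (α i)).trans_le (h.abs_kink_le i))

theorem lt_abs_of_isApexMixed (h : IsGenericLift m M α w ε) (hpt : p ≠ t) (hw : w t < w p)
    (hm : ∀ i, IsLeast (realSupport B i) (m i)) (hM : ∀ i, IsGreatest (realSupport B i) (M i))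
    (hl : IsApexMixed t (lowerFace (curveSupports B) (fun i => linearLift α w i) l)) :
    ε < |l (1, 0)| := by
  by_contra! hle
  exact lt_asymm (h.dualGraph_lt _ hle t p hw) ((le_of_isApexMixed_lowerFace hm hM hpt hl).trans_lt
    ((lowerFace_linearLift_eq_apex_iff hm hM).1 hl.1))

theorem isApexMixed_cases (h : IsGenericLift m M α w ε) (hlab : IsLabelling p o t)
    (hw : w t < w p) (hm : ∀ i, IsLeast (realSupport B i) (m i))
    (hM : ∀ i, IsGreatest (realSupport B i) (M i))
    (hl : IsApexMixed t (lowerFace (curveSupports B) (fun i => linearLift α w i) l)) :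
    MeetsBelow (dualGraph m M α w) ε p o t ∧
        lowerFace (curveSupports B) (fun i => linearLift α w i) l = slantCell t m ∨
      MeetsBelow (dualGraph (-M) (-m) (-α) w) ε p o t ∧
        lowerFace (curveSupports B) (fun i => linearLift α w i) l = slantCell t M := by
  have hε := h.lt_abs_of_isApexMixed hlab.ne₁₃ hw hm hM hl
  have hx (i : Fin 3) : l (1, 0) + α i ≠ 0 := fun h0 =>
    hε.not_ge ((abs_eq_abs.2 (.inr (eq_neg_of_add_eq_zero_left h0))).trans_le (h.abs_kink_le i))
  have hp := eq_of_isApexMixed_lowerFace hm hM (hx p) hlab.ne₁₃ hl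
  have ho := eq_of_isApexMixed_lowerFace hm hM (hx o) hlab.ne₂₃ hl
  have ht := (lowerFace_linearLift_eq_apex_iff hm hM).1 hl.1
  rw [lowerFace_linearLift_eq_slantCell hm hM hx hl]
  have hα (i : Fin 3) := abs_le.1 (h.abs_kink_le i)
  rcases lt_abs.1 hε with hpos | hneg
  · refine .inl ⟨⟨_, hpos, hp.symm.trans ho, hp ▸ ht⟩, congrArg _ (funext fun i => ?_)⟩
    exact if_neg (by linarith [(hα i).1])
  · refine .inr ⟨⟨_, hneg, ?_⟩, congrArg _ (funext fun i => if_pos (by linarith [(hα i).2]))⟩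
    simp only [dualGraph_reflect]
    exact ⟨hp.symm.trans ho, hp ▸ ht⟩

theorem mixedExponent_le (h : IsGenericLift m M α w ε) (hlab : IsLabelling p o t)
    (hw : w t < w p) (hm : ∀ i, IsLeast (realSupport B i) (m i))
    (hM : ∀ i, IsGreatest (realSupport B i) (M i))
    (hS : IsInducedBy (curveSupports B) (fun i => linearLift α w i) S) :
    mixedExponent S t ≤ slantArea m (dualGraph m M α w) ε p o t +
      slantArea (-M) (dualGraph (-M) (-m) (-α) w) ε p o t := by
  have hneg : |(-M) o - (-M) p| = |M o - M p| := by
    rw [Pi.neg_apply, Pi.neg_apply, neg_sub_neg, abs_sub_comm]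
  classical
  unfold mixedExponent slantArea
  rw [hneg, ← volume_real_slantCell hlab m, ← volume_real_slantCell hlab M]
  refine sum_le_ite_add_ite (fun _ => measureReal_nonneg) fun R hR => ?_
  obtain ⟨hRS, hRt⟩ := Finset.mem_filter.1 hR
  obtain ⟨l, rfl, -⟩ := (hS R).1 hRS
  exact h.isApexMixed_cases hlab hw hm hM hRt

theorem sum_mul_mixedExponent_le (h : IsGenericLift m M α w ε) (hl : IsLabelling p q r)
    (hq : w q < w p) (hr : w r < w p) (hm : ∀ i, IsLeast (realSupport B i) (m i))
    (hM : ∀ i, IsGreatest (realSupport B i) (M i))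
    (hS : IsInducedBy (curveSupports B) (fun i => linearLift α w i) S) :
    ∑ i, (w p - w i) * mixedExponent S i ≤
      endCost m (fun i => w p - w i) p q r + endCost (-M) (fun i => w p - w i) p q r := by
  have hmM : m ≤ M := fun i => (hm i).2 (hM i).1
  have hright := h.slantArea_add_slantArea_le_endCost hl hmM hq hr
  have hleft := h.reflect.slantArea_add_slantArea_le_endCost hl (neg_le_neg hmM) hq hr
  have hSq := mul_le_mul_of_nonneg_left (h.mixedExponent_le hl.swap₂₃ hq hm hM hS)
    (sub_pos.2 hq).le
  have hSr := mul_le_mul_of_nonneg_left (h.mixedExponent_le hl hr hm hM hS) (sub_pos.2 hr).le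
  rw [hl.sum_eq]
  linarith

end IsGenericLift

theorem abs_dualGraph_sub_le {m M α w : Fin 3 → ℝ} {ε K x : ℝ} {i : Fin 3} (hm : |m i| ≤ K)
    (hM : |M i| ≤ K) (hα : |α i| ≤ ε) (hx : |x| ≤ ε) :
    |dualGraph m M α w i x - w i| ≤ 2 * ε * K := by
  have hsum : |x + α i| ≤ 2 * ε := (abs_add_le _ _).trans (by linarith)
  rw [dualGraph, add_sub_cancel_left]
  rcases min_choice ((x + α i) * m i) ((x + α i) * M i) with h | h <;> rw [h, abs_mul]
  exacts [mul_le_mul hsum hm (abs_nonneg _) ((abs_nonneg _).trans hsum),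
    mul_le_mul hsum hM (abs_nonneg _) ((abs_nonneg _).trans hsum)]

theorem eventually_lineDet_mul_pos {a s : Fin 3 → ℝ} (hs : IsGenericWeight s a)
    (v : Fin 3 → ℝ) : ∀ᶠ ε : ℝ in 𝓝 0, ∀ p q r, IsLabelling p q r → s p ≠ s q →
      0 < lineDet (a + ε • v) s p q r * lineDet a s p q r := by
  simp only [eventually_all]
  intro p q r hl hpq
  have hcont : Continuous fun ε : ℝ => lineDet (a + ε • v) s p q r * lineDet a s p q r := by
    simp only [lineDet, Pi.add_apply, Pi.smul_apply, smul_eq_mul]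
    fun_prop
  refine hcont.continuousAt.eventually (lt_mem_nhds ?_)
  simpa using mul_self_pos.2 (hs p q r hl hpq)

theorem exists_isGenericLift {m M w : Fin 3 → ℝ} (hm : IsGenericWeight m w)
    (hM : IsGenericWeight M w) : ∃ α ε, IsGenericLift m M α w ε := by
  set c : Fin 3 → ℝ := fun i => (i : ℝ) / 2 with hc
  have hgap : ∀ᶠ ε : ℝ in 𝓝 0, ∀ i j, w i < w j → 4 * ε * max ‖m‖ ‖M‖ < w j - w i := by
    simp only [eventually_all]
    refine fun i j hij => ContinuousAt.eventually_lt (by fun_prop) (by fun_prop) ?_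
    simpa using hij
  obtain ⟨ε, ⟨⟨hgap, hm'⟩, hM'⟩, hε⟩ := (((hgap.and (eventually_lineDet_mul_pos hm (c * m))).and
    (eventually_lineDet_mul_pos hM (c * M))).filter_mono nhdsWithin_le_nhds).and
    (self_mem_nhdsWithin (s := Set.Ioi (0 : ℝ))) |>.exists
  have hα (i : Fin 3) : |(ε • c) i| ≤ ε := by
    have hi : (i : ℝ) ≤ 2 := by exact_mod_cast Nat.lt_succ_iff.1 i.isLt
    rw [Pi.smul_apply, smul_eq_mul, hc, abs_of_nonneg (mul_nonneg hε.le (by positivity))]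
    exact mul_le_of_le_one_right hε.le (by linarith)
  refine ⟨ε • c, ε, ?_, hα, fun x hx i j hij => ?_, ?_, ?_⟩
  · intro i j hij
    have hcij : c i = c j := mul_left_cancel₀ hε.ne' hij
    exact Fin.ext (by exact_mod_cast (div_left_inj' (two_ne_zero (α := ℝ))).1 hcij)
  · have hK (k : Fin 3) := abs_le.1 (abs_dualGraph_sub_le (w := w)
      ((norm_le_pi_norm m k).trans (le_max_left _ ‖M‖))
      ((norm_le_pi_norm M k).trans (le_max_right ‖m‖ _)) (hα k) hx)
    linarith [hgap i j hij, (hK i).2, (hK j).1]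
  · simpa only [smul_mul_assoc] using hm'
  · simpa only [smul_mul_assoc] using hM'

theorem exists_isLabelling_max (w : Fin 3 → ℝ) :
    ∃ p q r, IsLabelling p q r ∧ ∀ i, w i ≤ w p := by
  obtain ⟨p, hp⟩ := Finite.exists_max w
  obtain ⟨q, r, hl⟩ : ∃ q r, IsLabelling p q r :=
    ⟨p + 1, p + 2, by constructor <;> omega⟩
  exact ⟨p, q, r, hl, hp⟩

/-! ### The points obtained by linear liftings -/

section Separation

theorem eventually_residual_ne_zero {E : Type*} [AddCommGroup E] [TopologicalSpace E]
    [ContinuousAdd E] [Module ℝ E] [ContinuousSMul ℝ E] {φ : StrongDual ℝ E} (hφ : φ ≠ 0) :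
    ∀ᶠ v in residual E, φ v ≠ 0 :=
  residual_of_dense_open (isOpen_ne.preimage φ.continuous)
    ((dense_compl_singleton (0 : ℝ)).preimage (φ.isOpenMap_of_ne_zero hφ))

theorem eventually_residual_injective {ι : Type*} [Finite ι] :
    ∀ᶠ w : ι → ℝ in residual (ι → ℝ), Function.Injective w := by
  classical
  have hne (i j : ι) (hij : i ≠ j) :
      (.proj i - .proj j : StrongDual ℝ (ι → ℝ)) ≠ 0 := fun h => by
    simpa [hij.symm] using DFunLike.congr_fun h (Pi.single i 1)
  simp only [Function.Injective, ← not_imp_not (b := _ = _), eventually_all]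
  exact fun i j hij => (eventually_residual_ne_zero (hne i j hij)).mono fun w => sub_ne_zero.1

theorem mem_convexHull_of_dense {ι : Type*} [Fintype ι] {X D : Set (ι → ℝ)} (hX : X.Finite)
    (hD : Dense D) {p : ι → ℝ} (h : ∀ w ∈ D, ∃ x ∈ X, w ⬝ᵥ p ≤ w ⬝ᵥ x) : p ∈ convexHull ℝ X := by
  classical
  by_contra hp
  obtain ⟨f, u, hf, hu⟩ := geometric_hahn_banach_closed_point (convex_convexHull ℝ X)
    (hX.isCompact_convexHull ℝ).isClosed hp
  let U : Set (ι → ℝ) := ⋂ x ∈ X, {w | w ⬝ᵥ x < w ⬝ᵥ p}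
  have hU : IsOpen U := hX.isOpen_biInter fun x _ => by
    unfold dotProduct
    exact isOpen_lt (by fun_prop) (by fun_prop)
  obtain ⟨w₀, hw₀⟩ : ∃ w, ∀ y, w ⬝ᵥ y = f y :=
    ⟨_, LinearMap.congr_fun ((dotProductEquiv ℝ ι).apply_symm_apply f.toLinearMap)⟩
  have hw₀U : w₀ ∈ U := by
    simp only [U, Set.mem_iInter₂, Set.mem_ofPred_eq, hw₀]
    exact fun x hx => (hf x (subset_convexHull ℝ X hx)).trans hu
  obtain ⟨w, hwU, hwD⟩ := hD.inter_open_nonempty U hU ⟨w₀, hw₀U⟩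
  obtain ⟨x, hx, hle⟩ := h w hwD
  exact (Set.mem_iInter₂.1 hwU x hx).not_ge hle

theorem eventually_residual_isGenericWeight (s : Fin 3 → ℝ) :
    ∀ᶠ w in residual (Fin 3 → ℝ), IsGenericWeight s w := by
  simp only [IsGenericWeight, eventually_all]
  intro p q r hl hpq
  let φ : StrongDual ℝ (Fin 3 → ℝ) :=
    (s r - s p) • (.proj p - .proj q) - (s q - s p) • (.proj p - .proj r)
  have hφ : φ ≠ 0 := fun h => hpq <| by
    simpa [φ, hl.ne₁₃.symm, hl.ne₂₃.symm, sub_eq_zero, eq_comm] using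
      DFunLike.congr_fun h (Pi.single r 1)
  filter_upwards [eventually_residual_ne_zero hφ] with w hw
  simpa [φ, lineDet, mul_comm] using hw

end Separation

theorem finite_curveSupports (B : Fin 3 → Finset ℕ) (i : Fin 3) : (curveSupports B i).Finite := by
  rw [curveSupports_eq_apexSupport]
  exact ((finite_realSupport B i).image _).insert _

theorem finite_setOf_isMixedSubdivision {A : MinkowskiTriple} (hA : ∀ i, (A i).Finite) :
    {S | IsMixedSubdivision A S}.Finite := by
  have hfin := finite_setOf_forall_eq_convexHull hA
  refine hfin.toFinset.powerset.finite_toSet.subset fun S hS => ?_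
  refine Finset.mem_coe.2 (Finset.mem_powerset.2 fun R hR => hfin.mem_toFinset.2 fun i => ?_)
  obtain ⟨V, hV, -, h⟩ := (hS.1 R hR).1 i
  exact ⟨V, hV, h⟩

theorem IsMixedSubdivision.affDim_eq_two {A : MinkowskiTriple} {S : Finset MinkowskiTriple}
    (hS : IsMixedSubdivision A S) (hA : ∀ i, (A i).Nonempty) :
    affDim (MinkowskiTriple.total fun i => convexHull ℝ (A i)) = 2 := by
  obtain ⟨hcell, hcover, -⟩ := hS
  choose a ha using hA
  have hmem := MinkowskiTriple.sum_mem_total (R := fun i => convexHull ℝ (A i))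
    fun i => subset_convexHull ℝ _ (ha i)
  rw [← hcover] at hmem ⊢
  obtain ⟨R, hR, -⟩ := Set.mem_iUnion₂.1 hmem
  rw [affDim_eq_two_iff_vectorSpan_eq_top, eq_top_iff,
    ← affDim_eq_two_iff_vectorSpan_eq_top.1 (hcell R hR).2]
  exact vectorSpan_mono ℝ (Set.subset_biUnion_of_mem hR)

section CurveSupports

variable {B : Fin 3 → Finset ℕ} {S S' : Finset MinkowskiTriple} {m M w : Fin 3 → ℝ}

theorem IsTightMixedSubdivision.sum_mixedExponent_eq
    (hS : IsTightMixedSubdivision (curveSupports B) S)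
    (hS' : IsTightMixedSubdivision (curveSupports B) S')
    (hm : ∀ i, IsLeast (realSupport B i) (m i)) (hM : ∀ i, IsGreatest (realSupport B i) (M i)) :
    ∑ i, mixedExponent S i = ∑ i, mixedExponent S' i := by
  obtain ⟨s, t, h, hs, ht⟩ := hS.exists_path hm hM
  obtain ⟨s', t', h', hs', ht'⟩ := hS'.exists_path hm hM
  rw [h.sum_eq, h'.sum_eq,
    ((hs s'.a).trans h'.valid_left.mem_a.1).antisymm ((hs' s.a).trans h.valid_left.mem_a.1),
    (h.valid_right.mem_a.2.trans (ht' t.a)).antisymm (h'.valid_right.mem_a.2.trans (ht t'.a))]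

theorem IsTightMixedSubdivision.exists_isLinearlyInduced_le
    (hS : IsTightMixedSubdivision (curveSupports B) S)
    (hm : ∀ i, IsLeast (realSupport B i) (m i)) (hM : ∀ i, IsGreatest (realSupport B i) (M i))
    (hw : Function.Injective w) (hwm : IsGenericWeight m w) (hwM : IsGenericWeight M w) :
    ∃ S', IsTightMixedSubdivision (curveSupports B) S' ∧ IsLinearlyInduced (curveSupports B) S' ∧
      w ⬝ᵥ mixedExponent S ≤ w ⬝ᵥ mixedExponent S' := by
  obtain ⟨p, q, r, hl, hp⟩ := exists_isLabelling_max w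
  obtain ⟨α, ε, hα⟩ := exists_isGenericLift hwm hwM
  obtain ⟨S', hind⟩ := exists_isInducedBy (finite_curveSupports B) fun i => linearLift α w i
  have hS' : IsTightMixedSubdivision (curveSupports B) S' :=
    hα.isTightMixedSubdivision hw hm hM hind <| hind.isMixedSubdivision (finite_curveSupports B) <|
      hS.1.affDim_eq_two fun i => ⟨(0, 1), .inl rfl⟩
  refine ⟨S', hS', ⟨_, hind⟩, ?_⟩
  obtain ⟨s, t, hpath, hs, ht⟩ := hS.exists_path hm hM
  have hlower := hpath.endCost_add_endCost_le hl (W := fun i => w p - w i)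
    (fun i => sub_nonneg.2 (hp i)) hs ht fun i => (hm i).2 (hM i).1
  have hupper := hα.sum_mul_mixedExponent_le hl ((hp q).lt_of_ne (hw.ne hl.ne₁₂.symm))
    ((hp r).lt_of_ne (hw.ne hl.ne₁₃.symm)) hm hM hind
  have hsum := hS.sum_mixedExponent_eq hS' hm hM
  have := hupper.trans hlower
  simp only [sub_mul, Finset.sum_sub_distrib, ← Finset.mul_sum, hsum] at this
  exact (sub_le_sub_iff_left _).1 this

theorem IsTightMixedSubdivision.mixedExponent_mem_convexHull (hB : ∀ i, (B i).Nonempty)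
    (hS : IsTightMixedSubdivision (curveSupports B) S) :
    mixedExponent S ∈ convexHull ℝ (mixedExponent '' {S' |
      IsTightMixedSubdivision (curveSupports B) S' ∧ IsLinearlyInduced (curveSupports B) S'}) := by
  have hfin := (finite_setOf_isMixedSubdivision (finite_curveSupports B)).subset
    fun S' (h : IsTightMixedSubdivision (curveSupports B) S' ∧
      IsLinearlyInduced (curveSupports B) S') => h.1.1
  obtain ⟨m, hm⟩ : ∃ m : Fin 3 → ℝ, ∀ i, IsLeast (realSupport B i) (m i) :=
    ⟨_, fun i => Nat.mono_cast.map_isLeast ((B i).isLeast_min' (hB i))⟩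
  obtain ⟨M, hM⟩ : ∃ M : Fin 3 → ℝ, ∀ i, IsGreatest (realSupport B i) (M i) :=
    ⟨_, fun i => Nat.mono_cast.map_isGreatest ((B i).isGreatest_max' (hB i))⟩
  have hdense := dense_of_mem_residual <| eventually_residual_injective.and <|
    (eventually_residual_isGenericWeight m).and (eventually_residual_isGenericWeight M)
  refine mem_convexHull_of_dense (hfin.image _) hdense fun w ⟨hw, hwm, hwM⟩ => ?_
  obtain ⟨S', hS', hind, hle⟩ := hS.exists_isLinearlyInduced_le hm hM hw hwm hwM
  exact ⟨_, ⟨S', ⟨hS', hind⟩, rfl⟩, hle⟩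

theorem IsTightMixedSubdivision.obtainedPoint_mem_convexHull (hB : ∀ i, (B i).Nonempty)
    (hS : IsTightMixedSubdivision (curveSupports B) S) :
    obtainedPoint S ∈ convexHull ℝ {q | ∃ S', IsTightMixedSubdivision (curveSupports B) S' ∧
      IsLinearlyInduced (curveSupports B) S' ∧ q = obtainedPoint S'} := by
  let T : (Fin 3 → ℝ) →ₗ[ℝ] ℝ × ℝ := (LinearMap.proj 0).prod (LinearMap.proj 1)
  have hmem := Set.mem_image_of_mem T (hS.mixedExponent_mem_convexHull hB)
  rw [T.image_convexHull] at hmem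
  refine convexHull_mono ?_ hmem
  rintro _ ⟨_, ⟨S', ⟨hS', hind⟩, rfl⟩, rfl⟩
  exact ⟨S', hS', hind, rfl⟩

theorem IsLinearlyInduced.isRegularSubdivision {A : MinkowskiTriple}
    (hS : IsLinearlyInduced A S) : IsRegularSubdivision A S :=
  let ⟨_, h⟩ := hS
  ⟨_, h⟩

theorem convexHull_linearlyInduced_subset_implicitPolygon (B : Fin 3 → Finset ℕ) :
    convexHull ℝ {q | ∃ S, IsTightMixedSubdivision (curveSupports B) S ∧
      IsLinearlyInduced (curveSupports B) S ∧ q = obtainedPoint S} ⊆ implicitPolygon B :=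
  convexHull_mono fun _ ⟨S, hS, hind, hq⟩ => ⟨S, hS, hind.isRegularSubdivision, hq⟩

theorem IsTightMixedSubdivision.obtainedPoint_mem_implicitPolygon (hB : ∀ i, (B i).Nonempty)
    (hS : IsTightMixedSubdivision (curveSupports B) S) : obtainedPoint S ∈ implicitPolygon B :=
  convexHull_linearlyInduced_subset_implicitPolygon B (hS.obtainedPoint_mem_convexHull hB)

theorem implicitPolygon_eq_convexHull_linearlyInduced (hB : ∀ i, (B i).Nonempty) :
    implicitPolygon B = convexHull ℝ {q | ∃ S, IsTightMixedSubdivision (curveSupports B) S ∧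
      IsLinearlyInduced (curveSupports B) S ∧ q = obtainedPoint S} := by
  refine (convexHull_min ?_ (convex_convexHull ℝ _)).antisymm
    (convexHull_linearlyInduced_subset_implicitPolygon B)
  rintro _ ⟨S, hS, -, rfl⟩
  exact hS.obtainedPoint_mem_convexHull hB

theorem isEndpoint_of_mem_extremePoints {j : Fin 3} {c : ℕ}
    (h : ((c : ℝ), (0 : ℝ)) ∈ (convexHull ℝ (curveSupports B j)).extremePoints ℝ) :
    IsEndpoint B j c := by
  have hmem (b : ℕ) (hb : b ∈ B j) : ((b : ℝ), (0 : ℝ)) ∈ convexHull ℝ (curveSupports B j) :=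
    subset_convexHull ℝ _ (.inr ⟨b, hb, rfl⟩)
  have hc : c ∈ B j := by
    simpa [curveSupports] using extremePoints_convexHull_subset h
  refine ⟨hc, ?_⟩
  by_contra! hnot
  obtain ⟨⟨b, hb, hbc⟩, d, hd, hcd⟩ := hnot
  have hseg : ((c : ℝ), (0 : ℝ)) ∈ openSegment ℝ ((b : ℝ), (0 : ℝ)) ((d : ℝ), (0 : ℝ)) := by
    rw [← Prod.image_mk_openSegment_left, openSegment_eq_Ioo (Nat.cast_lt.2 (hbc.trans hcd))]
    exact ⟨c, ⟨Nat.cast_lt.2 hbc, Nat.cast_lt.2 hcd⟩, rfl⟩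
  have hbc' := (mem_extremePoints.1 h).2 _ (hmem b hb) _ (hmem d hd) hseg
  exact hbc.ne (by simpa using hbc'.1)

theorem IsLinearlyInduced.isEndpoint (hS : IsLinearlyInduced (curveSupports B) S) {j : Fin 3}
    {c : ℕ} (h : IsUsed S j c) : IsEndpoint B j c := by
  obtain ⟨ω, hω⟩ := hS
  obtain ⟨R, hR, hc⟩ := h
  obtain ⟨l, rfl, -⟩ := (hω R).1 hR
  rw [lowerFace_eq_toExposed] at hc
  exact isEndpoint_of_mem_extremePoints
    (ContinuousLinearMap.toExposed.isExposed.isExtreme.extremePoints_subset_extremePoints hc)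

theorem IsZeroFaceOnL.isUsed {i : Fin 3} {b : ℕ} (h : IsZeroFaceOnL S i b) : IsUsed S i b := by
  obtain ⟨R, hR, l, hl⟩ := h
  have hface : {((b : ℝ), (0 : ℝ))} = l.toExposed (R i) := by simpa using hl i
  refine ⟨R, hR, isExtreme_singleton.1 ?_⟩
  rw [hface]
  exact ContinuousLinearMap.toExposed.isExposed.isExtreme

theorem IsTightMixedSubdivision.obtainedPoint_mem_convexHull_isReplacement
    (hB : ∀ i, (B i).Nonempty) (hS : IsTightMixedSubdivision (curveSupports B) S) {i : Fin 3}
    {b : ℕ} (hb : ¬ IsEndpoint B i b) (hused : IsUsed S i b) :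
    obtainedPoint S ∈
      convexHull ℝ {q | ∃ S', S' ≠ S ∧ IsReplacement B S i b S' ∧ q = obtainedPoint S'} := by
  refine convexHull_mono ?_ (hS.obtainedPoint_mem_convexHull hB)
  rintro _ ⟨S', hS', hind, rfl⟩
  refine ⟨S', ?_, ⟨hS', fun j c hc => .inl (hind.isEndpoint hc)⟩, rfl⟩
  rintro rfl
  exact hb (hind.isEndpoint hused)

end CurveSupports

theorem mainTheorem4 (B : Fin 3 → Finset ℕ) (hB : ∀ i, (B i).Nonempty) :
    (∀ S : Finset MinkowskiTriple, IsTightMixedSubdivision (curveSupports B) S →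
      ∀ (i : Fin 3) (b : ℕ), b ∈ B i → ¬ IsEndpoint B i b → IsZeroFaceOnL S i b →
        obtainedPoint S ∈
          convexHull ℝ {q | ∃ S', S' ≠ S ∧ IsReplacement B S i b S' ∧ q = obtainedPoint S'} ∧
        (obtainedPoint S ∈ (implicitPolygon B).extremePoints ℝ →
          ∃ S', S' ≠ S ∧ IsReplacement B S i b S' ∧ obtainedPoint S' = obtainedPoint S)) ∧
    (∀ S : Finset MinkowskiTriple, IsTightMixedSubdivision (curveSupports B) S →
      obtainedPoint S ∈ implicitPolygon B) ∧
    implicitPolygon B =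
      convexHull ℝ {q | ∃ S, IsTightMixedSubdivision (curveSupports B) S ∧
        IsLinearlyInduced (curveSupports B) S ∧ q = obtainedPoint S} := by
  refine ⟨fun S hS i b _ hb hface => ?_, fun S hS => hS.obtainedPoint_mem_implicitPolygon hB,
    implicitPolygon_eq_convexHull_linearlyInduced hB⟩
  have hmem := hS.obtainedPoint_mem_convexHull_isReplacement hB hb hface.isUsed
  refine ⟨hmem, fun hext => ?_⟩
  have hsub : convexHull ℝ {q | ∃ S', S' ≠ S ∧ IsReplacement B S i b S' ∧ q = obtainedPoint S'} ⊆
      implicitPolygon B := by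
    refine convexHull_min ?_ (convex_convexHull ℝ _)
    rintro _ ⟨S', -, hS', rfl⟩
    exact hS'.1.obtainedPoint_mem_implicitPolygon hB
  obtain ⟨S', hne, hS', hq⟩ := extremePoints_convexHull_subset
    (inter_extremePoints_subset_extremePoints_of_subset hsub ⟨hmem, hext⟩)
  exact ⟨S', hne, hS', hq.symm⟩
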